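/- **Theorem 2.1 (existence of discrete solutions and discrete entropy inequalities).** Let $d\ge 2$ and let $\Omega\subset\mathbb R^d$ be a bounded polygonal (polyhedral) domain, that is, a connected set that is the interior of a finite union of closed convex polytopes. Let an admissible finite-volume mesh of $\Omega$ in the sense of Eymard, Gallouët and Herbin be given: a finite family $\mathcal T$ of disjoint open convex polytopes $K\subset\Omega$ (cells) whose closures cover $\overline\Omega$; a finite family $\mathcal E=\mathcal E_{\rm int}\cup\mathcal E_{\rm ext}$ of edges (faces), each contained in a hyperplane and of positive $(d-1)$-dimensional Hausdorff measure $\widetilde{\mathfrak m}(\sigma)$, where $\partial K=\bigcup_{\sigma\in\mathcal E_K}\overline\sigma$ for a set $\mathcal E_K\subset\mathcal E$, where two different closed cells meet in a $\widetilde{\mathfrak m}$-null set or in one common closed edge, where each $\sigma\in\mathcal E_{\rm int}$ is the common edge $\sigma=K|L$ of exactly two cells, and where each $\sigma\in\mathcal E_{\rm ext}$ lies in $\partial\Omega$ and belongs to exactly one cell; and points $x_K\in\overline K$ such that $x_K\ne x_L$ and the line through $x_K$ and $x_L$ is orthogonal to $\sigma$ whenever $\sigma=K|L$, and such that for $\sigma\in\mathcal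 E_{\rm ext}\cap\mathcal E_K$ with $x_K\notin\overline\sigma$ the line through $x_K$ orthogonal to $\sigma$ meets $\overline\sigma$. Let $\mathfrak m$ be the Lebesgue measure, let $\mathrm d_\sigma=|x_K-x_L|$ for $\sigma=K|L$ and $\mathrm d_\sigma=\mathrm d(x_K,\sigma)$ for $\sigma\in\mathcal E_{\rm ext}\cap\mathcal E_K$, let $\tau_\sigma=\widetilde{\mathfrak m}(\sigma)/\mathrm d_\sigma$ (with $\tau_\sigma=0$ if $\mathrm d_\sigma=0$), and assume that there is $\zeta>0$ with $\mathrm d(x_K,\sigma)\ge\zeta\,\mathrm d_\sigma$ for all $K\in\mathcal T$, $\sigma\in\mathcal E_K$. Let $T>0$, $N\in\mathbb N$, $N\ge1$, $\Delta t=T/N$. Let $B=(b_{ij})\in\mathbb R^{n\times n}$ be symmetric positive semidefinite with $\operatorname{rank}B\ge1$ and $b_{ii}>0$ for all $i$, let $0<\alpha<2$, $\eta\ge0$, and let $u^{\rm in}\in L^2(\Omega;[0,\infty)^n)$. Let $V_{\mathcal T}$ be the space of functions $v=\sum_{K}v_K\mathbf 1_K$ that are constant on the cells. For $v\in V_{\mathcal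 T}$ and $\sigma\in\mathcal E_K$ put $\mathrm D_{K,\sigma}v=v_L-v_K$ if $\sigma=K|L$, $\mathrm D_{K,\sigma}v=0$ if $\sigma\in\mathcal E_{\rm ext}$, $\mathrm D_\sigma v=|\mathrm D_{K,\sigma}v|$, and $|v|_{1,2,\mathcal T}^2=\sum_{\sigma\in\mathcal E}\widetilde{\mathfrak m}(\sigma)\mathrm d_\sigma|\mathrm D_\sigma v/\mathrm d_\sigma|^2$ (boundary edges contribute $0$); for a vector $v=(v_1,\dots,v_n)$ put $|v|^2_{1,2,\mathcal T}=\sum_i|v_i|^2_{1,2,\mathcal T}$. Let $p_i(u)=(Bu)_i=\sum_jb_{ij}u_j$. For $u^{k-1}\in V_{\mathcal T}^n$, a function $u^k\in V_{\mathcal T}^n$ is a *solution of the scheme* if for all $i=1,\dots,n$ and $K\in\mathcal T$ $$\mathfrak m(K)\frac{u^k_{i,K}-u^{k-1}_{i,K}}{\Delta t}+\sum_{\sigma\in\mathcal E_K}\mathcal F^k_{i,K,\sigma}=0,\qquad \mathcal F^k_{i,K,\sigma}=-\tau_\sigma u^k_{i,\sigma}\mathrm D_{K,\sigma}p_i(u^k)-\eta^\alpha\tau_\sigma\mathrm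 D_{K,\sigma}u^k_i,$$ with $0^\alpha=0$ and the upwind mobility, for $\sigma=K|L$, $u^k_{i,\sigma}=u^k_{i,L}$ if $\mathrm D_{K,\sigma}p_i(u^k)\ge0$ and $u^k_{i,\sigma}=u^k_{i,K}$ if $\mathrm D_{K,\sigma}p_i(u^k)<0$ (on boundary edges $u^k_{i,\sigma}=u^k_{i,K}$). Put $H_S(u)=\int_\Omega\sum_i(u_i(\log u_i-1)+1)\,dx$ (with $0\log0=0$) and $H_R(u)=\frac12\int_\Omega\sum_{i,j}b_{ij}u_iu_j\,dx$. Then: 1. (*Existence and positivity.*) For every $u^{k-1}\in V_{\mathcal T}^n$ with $u^{k-1}_{i,K}\ge0$ for all $i,K$ there is a solution $u^k\in V^n_{\mathcal T}$ of the scheme with $u^k_{i,K}\ge0$ for all $i,K$. Moreover, for every $i$ such that either $u^{k-1}_{i,K}>0$ for all $K$, or $\eta>0$ and $u_i^{k-1}\not\equiv0$, it satisfies $u^k_{i,K}>0$ for all $K\in\mathcal T$. In particular, if all values of $u^{k-1}$ are positive, then so are all values of $u^k$, for every $\eta\ge0$. 2. (*Entropy inequalities.*) Let $k\ge 0$, let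 $u^0\in V_{\mathcal T}^n$ be nonnegative, and let $u^j\in V_{\mathcal T}^n$, $j=1,\dots,k$, be nonnegative solutions of the scheme with previous iterate $u^{j-1}$. Then $$H_S(u^k)+\sum_{j=1}^k\Delta t\,|B^{1/2}u^j|_{1,2,\mathcal T}^2+4\eta^\alpha\sum_{j=1}^k\Delta t\sum_{i=1}^n|(u_i^j)^{1/2}|_{1,2,\mathcal T}^2\le H_S(u^0),$$ $$H_R(u^k)+\sum_{j=1}^k\Delta t\sum_{i=1}^n\sum_{\sigma\in\mathcal E}\tau_\sigma u^j_{i,\sigma}|\mathrm D_\sigma(Bu^j)_i|^2\le H_R(u^0),$$ and $H_R(u^k)\le H_R(u^{k-1})$ if $k\ge1$. 3. (*Scheme with initial datum $u^{\rm in}$.*) Let $u^0_{i,K}=\mathfrak m(K)^{-1}\int_Ku_i^{\rm in}\,dx$. Then $u^0_{i,K}\ge0$ and there are nonnegative $u^j\in V_{\mathcal T}^n$, $j\ge1$, such that each $u^j$ solves the scheme with previous iterate $u^{j-1}$. Moreover, for every $i$ such that either $u^0_{i,K}>0$ for all $K$, or $\eta>0$ and $\|u_i^{\rm in}\|_{L^1(\Omega)}>0$,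 one has $u^j_{i,K}>0$ for all $j\ge1$ and $K\in\mathcal T$. -/

import Mathlib

open MeasureTheory
open scoped BigOperators MatrixOrder

/-- An open convex polytope: a nonempty bounded set that is a finite intersection of open
half-spaces. -/
def IsOpenPolytope {d : ℕ} (P : Set (EuclideanSpace ℝ (Fin d))) : Prop :=
  P.Nonempty ∧ Bornology.IsBounded P ∧
    ∃ H : Finset (EuclideanSpace ℝ (Fin d) × ℝ), P = {x | ∀ h ∈ H, inner ℝ h.1 x < h.2}

/-- A bounded polygonal (polyhedral) domain: a connected set that is the interior of a finite
union of closed convex polytopes. It is open and bounded. -/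
def IsPolyhedralDomain {d : ℕ} (Ω : Set (EuclideanSpace ℝ (Fin d))) : Prop :=
  IsConnected Ω ∧
    ∃ S : Set (Set (EuclideanSpace ℝ (Fin d))), S.Finite ∧ (∀ P ∈ S, IsOpenPolytope P) ∧
      Ω = interior (⋃ P ∈ S, closure P)

/-- An admissible finite-volume mesh of `Ω` (Eymard, Gallouët, Herbin). The (finite) families of
control volumes, of edges (faces) and of cell centers are indexed by `Cell`, `Edge` and `Cell`.
Edges may be given with or without (parts of) their relative boundary. An edge is a boundary edge
if it lies in `∂Ω`; every other edge is an interior edge `σ = K|L`. -/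
structure AdmissibleMesh {d : ℕ} (Ω : Set (EuclideanSpace ℝ (Fin d))) where
  Cell : Type
  Edge : Type
  [fintypeCell : Fintype Cell]
  [fintypeEdge : Fintype Edge]
  /-- the control volume `K` as a set -/
  cell : Cell → Set (EuclideanSpace ℝ (Fin d))
  /-- the edge `σ` as a set -/
  edge : Edge → Set (EuclideanSpace ℝ (Fin d))
  /-- the point `x_K` -/
  center : Cell → EuclideanSpace ℝ (Fin d)
  /-- the set `ℰ_K` of edges of `K` -/
  edges : Cell → Finset Edge
  cell_polytope : ∀ K, IsOpenPolytope (cell K)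
  cell_subset : ∀ K, cell K ⊆ Ω
  cell_disjoint : ∀ K L, K ≠ L → Disjoint (cell K) (cell L)
  /-- the closure of the union of the cells is the closure of the domain -/
  closure_cells : closure (⋃ K, cell K) = closure Ω
  edge_subset : ∀ σ, edge σ ⊆ closure Ω
  edge_hyperplane : ∀ σ, ∃ a : EuclideanSpace ℝ (Fin d), a ≠ 0 ∧
    ∃ b : ℝ, ∀ x ∈ edge σ, inner ℝ a x = b
  edge_pos : ∀ σ, 0 < (μHE[d - 1] : Measure (EuclideanSpace ℝ (Fin d))) (edge σ)
  /-- the boundary of a cell is the union of its (closed) edges -/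
  frontier_cell : ∀ K, frontier (cell K) = ⋃ σ ∈ edges K, closure (edge σ)
  /-- two different closed cells meet in a set of zero `(d-1)`-dimensional measure, or in a
  common (closed) edge -/
  cell_inter : ∀ K L, K ≠ L →
    (μHE[d - 1] : Measure (EuclideanSpace ℝ (Fin d))) (closure (cell K) ∩ closure (cell L)) = 0 ∨
      ∃ σ, σ ∈ edges K ∧ σ ∈ edges L ∧ closure (edge σ) = closure (cell K) ∩ closure (cell L)
  /-- the common edge `K|L` is unique -/
  common_edge_unique : ∀ K L, K ≠ L → ∀ σ σ', σ ∈ edges K → σ ∈ edges L →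
    σ' ∈ edges K → σ' ∈ edges L → σ = σ'
  /-- every interior edge is `K|L` for exactly two cells `K ≠ L` -/
  interior_edge : ∀ σ, ¬ edge σ ⊆ frontier Ω → ∃ K L, K ≠ L ∧
    closure (edge σ) = closure (cell K) ∩ closure (cell L) ∧ ∀ M, σ ∈ edges M ↔ M = K ∨ M = L
  /-- every boundary edge belongs to exactly one cell -/
  boundary_edge : ∀ σ, edge σ ⊆ frontier Ω → ∃! K, σ ∈ edges K
  center_mem : ∀ K, center K ∈ closure (cell K)
  /-- neighboring centers are different, and the line through them is orthogonal to the edge -/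
  center_ne : ∀ K L, K ≠ L → ∀ σ, σ ∈ edges K → σ ∈ edges L → center K ≠ center L
  orthogonal : ∀ K L, K ≠ L → ∀ σ, σ ∈ edges K → σ ∈ edges L →
    ∀ y ∈ edge σ, ∀ z ∈ edge σ, inner ℝ (center L - center K) (z - y) = 0
  /-- for a boundary edge of `K`, the line through `x_K` orthogonal to the edge meets the closed
  edge (no condition if `x_K` itself lies on the closed edge) -/
  boundary_orthogonal : ∀ K σ, σ ∈ edges K → edge σ ⊆ frontier Ω →
    ∃ p ∈ closure (edge σ), ∀ y ∈ edge σ, ∀ z ∈ edge σ, inner ℝ (p - center K) (z - y) = 0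

attribute [instance] AdmissibleMesh.fintypeCell AdmissibleMesh.fintypeEdge

namespace AdmissibleMesh

variable {d : ℕ} {Ω : Set (EuclideanSpace ℝ (Fin d))} (M : AdmissibleMesh Ω)

theorem exists_side (σ : M.Edge) : ∃ K, σ ∈ M.edges K := by
  by_cases h : M.edge σ ⊆ frontier Ω
  · obtain ⟨K, hK, -⟩ := M.boundary_edge σ h
    exact ⟨K, hK⟩
  · obtain ⟨K, L, -, -, hM⟩ := M.interior_edge σ h
    exact ⟨K, (hM K).2 (Or.inl rfl)⟩

/-- A cell `K` with `σ ∈ ℰ_K`, fixed for every edge `σ`. -/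
noncomputable def side (σ : M.Edge) : M.Cell := (M.exists_side σ).choose

open Classical in
/-- The cell on the other side of `σ ∈ ℰ_K`: it is `L` if `σ = K|L` is an interior edge and `K`
itself if `σ` is a boundary edge, so that `v_{K,σ} = v (opp K σ)`. -/
noncomputable def opp (K : M.Cell) (σ : M.Edge) : M.Cell :=
  if h : ∃ L, L ≠ K ∧ σ ∈ M.edges L then h.choose else K

theorem side_mem (σ : M.Edge) : σ ∈ M.edges (M.side σ) := (M.exists_side σ).choose_spec

theorem opp_of_interior {K L : M.Cell} {σ : M.Edge} (hKL : K ≠ L) (hK : σ ∈ M.edges K)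
    (hL : σ ∈ M.edges L) : M.opp K σ = L := by
  have h : ∃ L, L ≠ K ∧ σ ∈ M.edges L := ⟨L, hKL.symm, hL⟩
  have hs := h.choose_spec
  rw [opp, dif_pos h]
  by_cases hb : M.edge σ ⊆ frontier Ω
  · exact absurd ((M.boundary_edge σ hb).unique hK hL) hKL
  · obtain ⟨K', L', -, -, hM⟩ := M.interior_edge σ hb
    have h1 := (hM K).1 hK
    have h2 := (hM L).1 hL
    have h3 := (hM h.choose).1 hs.2
    have h4 := hs.1
    grind

theorem opp_of_boundary {K : M.Cell} {σ : M.Edge} (hσ : M.edge σ ⊆ frontier Ω)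
    (hK : σ ∈ M.edges K) : M.opp K σ = K := by
  have h : ¬ ∃ L, L ≠ K ∧ σ ∈ M.edges L := fun ⟨L, hL, hL'⟩ =>
    hL ((M.boundary_edge σ hσ).unique hL' hK)
  rw [opp, dif_neg h]

open Classical in
/-- `d_σ = d(x_K, x_L)` if `σ = K|L`, and `d_σ = d(x_K, σ)` if `σ` is a boundary edge of `K`. -/
noncomputable def edgeDist (σ : M.Edge) : ℝ :=
  if M.edge σ ⊆ frontier Ω then Metric.infDist (M.center (M.side σ)) (M.edge σ)
  else dist (M.center (M.side σ)) (M.center (M.opp (M.side σ) σ))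

/-- The `(d-1)`-dimensional Hausdorff measure of `σ`. -/
noncomputable def edgeMeas (σ : M.Edge) : ℝ :=
  (μHE[d - 1] : Measure (EuclideanSpace ℝ (Fin d))).real (M.edge σ)

/-- The Lebesgue measure of the cell `K`. -/
noncomputable def cellMeas (K : M.Cell) : ℝ := volume.real (M.cell K)

/-- The transmissibility coefficient `τ_σ`. -/
noncomputable def trans (σ : M.Edge) : ℝ := M.edgeMeas σ / M.edgeDist σ

/-- Mesh regularity: `d(x_K, σ) ≥ ζ d_σ` for some `ζ > 0` and all `K`, `σ ∈ ℰ_K`. -/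
def IsRegular : Prop :=
  ∃ ζ : ℝ, 0 < ζ ∧ ∀ K, ∀ σ ∈ M.edges K,
    ζ * M.edgeDist σ ≤ Metric.infDist (M.center K) (M.edge σ)

/-- The piecewise constant function `∑_K v_K 1_K` with cell values `v`; the space `V_𝒯` of these
functions is identified with `Cell → ℝ`. -/
noncomputable def pc (v : M.Cell → ℝ) (x : EuclideanSpace ℝ (Fin d)) : ℝ :=
  ∑ K, (M.cell K).indicator (fun _ => v K) x

/-- `D_{K,σ} v = v_{K,σ} - v_K`. -/
noncomputable def jump (v : M.Cell → ℝ) (K : M.Cell) (σ : M.Edge) : ℝ := v (M.opp K σ) - v K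

/-- `D_σ v = |D_{K,σ} v|`, where `σ ∈ ℰ_K`. -/
noncomputable def absJump (v : M.Cell → ℝ) (σ : M.Edge) : ℝ := |M.jump v (M.side σ) σ|

/-- `D_σ v` does not depend on the choice of the cell. -/
theorem absJump_eq (v : M.Cell → ℝ) {K : M.Cell} {σ : M.Edge} (hK : σ ∈ M.edges K) :
    M.absJump v σ = |M.jump v K σ| := by
  by_cases h : K = M.side σ
  · rw [absJump, h]
  · rw [absJump, jump, jump, M.opp_of_interior h hK (M.side_mem σ),
      M.opp_of_interior (Ne.symm h) (M.side_mem σ) hK, abs_sub_comm]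

/-- The square of the discrete `W^{1,2}` seminorm,
`|v|_{1,2,𝒯}² = ∑_σ m(σ) d_σ |D_σ v / d_σ|²`. -/
noncomputable def seminormSq (v : M.Cell → ℝ) : ℝ :=
  ∑ σ, M.edgeMeas σ * M.edgeDist σ * |M.absJump v σ / M.edgeDist σ| ^ 2

variable {n : ℕ}

/-- `p_i(u) = (B u)_i = ∑_j b_ij u_j` as a function of the cell. -/
noncomputable def pressure (B : Matrix (Fin n) (Fin n) ℝ) (u : Fin n → M.Cell → ℝ) (i : Fin n)
    (K : M.Cell) : ℝ :=
  ∑ j, B i j * u j K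

open Classical in
/-- The upwind mobility `u_{i,σ}`, seen from `K`. -/
noncomputable def mobility (B : Matrix (Fin n) (Fin n) ℝ) (u : Fin n → M.Cell → ℝ) (i : Fin n)
    (K : M.Cell) (σ : M.Edge) : ℝ :=
  if 0 ≤ M.jump (M.pressure B u i) K σ then u i (M.opp K σ) else u i K

/-- The numerical flux `ℱ_{i,K,σ}`. -/
noncomputable def flux (η α : ℝ) (B : Matrix (Fin n) (Fin n) ℝ) (u : Fin n → M.Cell → ℝ)
    (i : Fin n) (K : M.Cell) (σ : M.Edge) : ℝ :=
  -(M.trans σ * M.mobility B u i K σ * M.jump (M.pressure B u i) K σ)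
    - η ^ α * M.trans σ * M.jump (u i) K σ

/-- `u` solves one step of the implicit Euler finite-volume scheme with previous iterate `v`. -/
def IsStep (Δt η α : ℝ) (B : Matrix (Fin n) (Fin n) ℝ) (v u : Fin n → M.Cell → ℝ) : Prop :=
  ∀ i K, M.cellMeas K * ((u i K - v i K) / Δt) + ∑ σ ∈ M.edges K, M.flux η α B u i K σ = 0

/-- The discrete initial datum: the cell averages of `uin`. -/
noncomputable def average (uin : Fin n → EuclideanSpace ℝ (Fin d) → ℝ) (i : Fin n)
    (K : M.Cell) : ℝ :=
  (M.cellMeas K)⁻¹ * ∫ x in M.cell K, uin i x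

/-- The Shannon entropy `H_S(u) = ∫_Ω ∑_i (u_i (log u_i - 1) + 1) dx` (with `0 log 0 = 0`). -/
noncomputable def shannon (u : Fin n → M.Cell → ℝ) : ℝ :=
  ∫ x in Ω, ∑ i, (M.pc (u i) x * (Real.log (M.pc (u i) x) - 1) + 1)

/-- The Rao entropy `H_R(u) = ∫_Ω (1/2) ∑_{i,j} b_ij u_i u_j dx`. -/
noncomputable def rao (B : Matrix (Fin n) (Fin n) ℝ) (u : Fin n → M.Cell → ℝ) : ℝ :=
  ∫ x in Ω, (1 / 2) * ∑ i, ∑ j, B i j * M.pc (u i) x * M.pc (u j) x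

/-- `|B^{1/2} u|_{1,2,𝒯}² = ∑_i |(B^{1/2} u)_i|_{1,2,𝒯}²`. -/
noncomputable def sqrtSeminormSq (B : Matrix (Fin n) (Fin n) ℝ) (u : Fin n → M.Cell → ℝ) : ℝ :=
  ∑ i, M.seminormSq (fun K => ∑ j, CFC.sqrt B i j * u j K)

/-- `∑_i ∑_σ τ_σ u_{i,σ} |D_σ (B u)_i|²`. -/
noncomputable def raoDissipation (B : Matrix (Fin n) (Fin n) ℝ) (u : Fin n → M.Cell → ℝ) : ℝ :=
  ∑ i, ∑ σ, M.trans σ * M.mobility B u i (M.side σ) σ * M.absJump (M.pressure B u i) σ ^ 2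

end AdmissibleMesh

/-! Existence for one time step is a fixed point argument on the compact convex set `S` of
nonnegative cell values having, for each species, the mass of the previous iterate. Adding a small
multiple of the residual of the scheme maps `S` to itself: the fluxes are conservative, so mass is
kept, and upwinding makes every outflow from `K` proportional to `u i K`, so a small enough step
cannot create negative values. No a priori estimate or degree argument is needed. Written with
positive and negative parts, the upwind flux is locally Lipschitz, so Brouwer's theorem for
Lipschitz maps suffices (`exists_fixedPoint_of_lipschitzOn`).

That theorem follows from the volume argument against retractions. If `x + g x` maps a ball to its
sphere and is the identity outside, then for small `t` the map `x + t g x` is a bijection of the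
ball, so the integral of `det (1 + t Dg)` is the volume of the ball. The integrand is a polynomial
in `t`, so the same holds at `t = 1`, where the determinant vanishes almost everywhere.

Positivity is a discrete strong maximum principle (`IsStep.zero_at`, `IsStep.pos`): at a zero of a
solution the previous value and, if `η > 0`, all neighboring values vanish. The cell graph is
connected because a closed set of zero `(d-1)`-dimensional measure cannot separate a ball inside the
connected set `Ω` (`eq_univ_of_neighbor_closed`).

The entropy inequalities come from convexity and testing the scheme: with `log (u i + ε)`, `ε → 0`,
for the Shannon entropy, and with `(B u)_i` for the Rao entropy. Upwinding gives the sign needed in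
the discrete chain rule for the logarithm (`upwind_mul_log_ge`). -/

/-! ### Brouwer's fixed point theorem for Lipschitz maps -/

section LipschitzFixedPoint

variable {E : Type*} [NormedAddCommGroup E] [InnerProductSpace ℝ E]

/-- The metric projection onto a nonempty complete convex set is nonexpansive. -/
theorem exists_lipschitz_projection {K : Set E} (hne : K.Nonempty) (hc : IsComplete K)
    (hconv : Convex ℝ K) :
    ∃ π : E → E, LipschitzWith 1 π ∧ (∀ x, π x ∈ K) ∧ (∀ x ∈ K, π x = x) ∧
      ∀ x, ∀ w ∈ K, inner ℝ (x - π x) (w - π x) ≤ 0 := by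
  choose π hπK hπ using exists_norm_eq_iInf_of_complete_convex hne hc hconv
  have key : ∀ u, ∀ w ∈ K, inner ℝ (u - π u) (w - π u) ≤ 0 := fun u =>
    (norm_eq_iInf_iff_real_inner_le_zero hconv (hπK u)).1 (hπ u)
  refine ⟨π, LipschitzWith.of_dist_le_mul fun x y => ?_, hπK, fun x hx => ?_, key⟩
  · have h1 := key x (π y) (hπK y)
    have h2 := key y (π x) (hπK x)
    -- Adding the two variational inequalities gives firm nonexpansiveness; Cauchy-Schwarz then
    -- gives the constant 1.
    have h3 : ‖π x - π y‖ ^ 2 ≤ inner ℝ (x - y) (π x - π y) := by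
      rw [← real_inner_self_eq_norm_sq]
      simp only [inner_sub_left, inner_sub_right] at h1 h2 ⊢
      linarith [real_inner_comm (π x) (π y)]
    have h4 := real_inner_le_norm (x - y) (π x - π y)
    rw [dist_eq_norm, dist_eq_norm, NNReal.coe_one, one_mul]
    by_contra! h
    have : 0 < ‖π x - π y‖ := (norm_nonneg _).trans_lt h
    nlinarith
  · have := key x x hx
    rw [real_inner_self_eq_norm_sq] at this
    have h0 : ‖x - π x‖ = 0 := by nlinarith [norm_nonneg (x - π x)]
    exact (sub_eq_zero.1 (norm_eq_zero.1 h0)).symm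

/-- A small Lipschitz perturbation of the identity is bijective. -/
theorem bijective_id_add_of_lipschitz {F : Type*} [NormedAddCommGroup F] [NormedSpace ℝ F]
    [CompleteSpace F] {g : F → F} {C : NNReal} (hg : LipschitzWith C g) (hC : C < 1) :
    Function.Bijective fun x => x + g x := by
  constructor
  · intro x y hxy
    have h1 : x - y = g y - g x := by
      have : x + g x = y + g y := hxy
      rw [sub_eq_sub_iff_add_eq_add, this, add_comm]
    have h2 := hg.dist_le_mul y x
    rw [dist_eq_norm, dist_eq_norm, ← h1, norm_sub_rev y x] at h2
    have h3 : ((C : NNReal) : ℝ) < 1 := by exact_mod_cast hC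
    by_contra hne
    have : 0 < ‖x - y‖ := norm_pos_iff.2 (sub_ne_zero.2 hne)
    nlinarith
  · intro y
    have hcon : ContractingWith C fun x => y - g x := by
      refine ⟨hC, LipschitzWith.of_dist_le_mul fun a b => ?_⟩
      rw [dist_sub_left]
      exact hg.dist_le_mul a b
    obtain ⟨x, hx, -⟩ := hcon.exists_fixedPoint 0 (edist_ne_top _ _)
    refine ⟨x, ?_⟩
    have hx' : y - g x = x := hx
    show x + g x = y
    rw [← eq_sub_iff_add_eq, hx']

/-- `det (1 + t A)` is a polynomial in `t` of degree at most the dimension. -/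
theorem exists_polynomial_det_one_add_smul {F : Type*} [NormedAddCommGroup F] [NormedSpace ℝ F]
    [FiniteDimensional ℝ F] (A : F →L[ℝ] F) :
    ∃ p : Polynomial ℝ, p.natDegree ≤ Module.finrank ℝ F ∧
      ∀ t : ℝ, p.eval t = (1 + t • A).det := by
  classical
  let b := Module.finBasis ℝ F
  let M := LinearMap.toMatrix b b (A : F →ₗ[ℝ] F)
  refine ⟨((Polynomial.X : Polynomial ℝ) • M.map Polynomial.C +
    (1 : Matrix (Fin (Module.finrank ℝ F)) (Fin (Module.finrank ℝ F)) ℝ).map Polynomial.C).det,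
    ?_, fun t => ?_⟩
  · simpa using Polynomial.natDegree_det_X_add_C_le M 1
  · have hmap := RingHom.map_det (Polynomial.evalRingHom t) ((Polynomial.X : Polynomial ℝ) •
      M.map Polynomial.C + (1 : Matrix _ _ ℝ).map Polynomial.C)
    rw [Polynomial.coe_evalRingHom] at hmap
    rw [hmap]
    have : (1 + t • A).det = LinearMap.det ((1 + t • A : F →L[ℝ] F) : F →ₗ[ℝ] F) := rfl
    rw [this, ← LinearMap.det_toMatrix b]
    congr 1
    ext i j
    rw [LinearMap.toMatrix_apply]
    by_cases hij : i = j
    · subst hij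
      simp [M, LinearMap.toMatrix_apply]
      ring
    · simp [M, LinearMap.toMatrix_apply, hij]
      ring

open Classical in
/-- Values of polynomials of degree at most `m` at `1` are affine combinations of their values at
`m + 1` points of any interval `(0, ε)`. -/
theorem exists_extrapolation (m : ℕ) {ε : ℝ} (hε : 0 < ε) :
    ∃ t c : Fin (m + 1) → ℝ, (∀ j, 0 < t j ∧ t j < ε) ∧ ∑ j, c j = 1 ∧
      ∀ p : Polynomial ℝ, p.natDegree ≤ m → p.eval 1 = ∑ j, c j * p.eval (t j) := by
  -- Equispaced interior nodes: the shift by 1 and the denominator `m + 2` keep them off both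
  -- endpoints.
  let t : Fin (m + 1) → ℝ := fun j => ε * ((j : ℝ) + 1) / (m + 2)
  have hinj : Function.Injective t := by
    intro i j hij
    have hm : (m : ℝ) + 2 ≠ 0 := by positivity
    simp only [t, div_left_inj' hm, mul_right_inj' hε.ne', add_left_inj, Nat.cast_inj] at hij
    exact Fin.ext hij
  have hval : ∀ p : Polynomial ℝ, p.natDegree ≤ m →
      p.eval 1 = ∑ j, (Lagrange.basis Finset.univ t j).eval 1 * p.eval (t j) := by
    intro p hp
    have hdeg : p.degree < ((Finset.univ : Finset (Fin (m + 1))).card : WithBot ℕ) := by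
      rw [Finset.card_univ, Fintype.card_fin]
      exact (Polynomial.degree_le_natDegree).trans_lt (by exact_mod_cast Nat.lt_succ_of_le hp)
    conv_lhs => rw [Lagrange.eq_interpolate (s := Finset.univ) (v := t) hinj.injOn hdeg]
    rw [Lagrange.interpolate_apply, Polynomial.eval_finsetSum]
    refine Finset.sum_congr rfl fun j _ => ?_
    rw [Polynomial.eval_mul, Polynomial.eval_C, mul_comm]
  refine ⟨t, fun j => (Lagrange.basis Finset.univ t j).eval 1, fun j => ⟨?_, ?_⟩, ?_, hval⟩
  · positivity
  · have hj : (j : ℝ) + 1 < m + 2 := by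
      have : (j : ℝ) < m + 1 := by exact_mod_cast j.2
      linarith
    rw [div_lt_iff₀ (by positivity)]
    exact mul_lt_mul_of_pos_left hj hε
  -- The weights sum to 1 because the formula is exact for the constant polynomial 1.
  · simpa using (hval 1 (by simp)).symm

/-- The radial map onto a sphere is Lipschitz away from the origin. -/
theorem dist_normalize_le {R δ : ℝ} (hR : 0 < R) (hδ : 0 < δ) {y z : E} (hy : δ ≤ ‖y‖)
    (hz : δ ≤ ‖z‖) : dist ((R / ‖y‖) • y) ((R / ‖z‖) • z) ≤ 2 * R / δ * dist y z := by
  have hy0 : 0 < ‖y‖ := hδ.trans_le hy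
  have hz0 : 0 < ‖z‖ := hδ.trans_le hz
  have h1 : (R / ‖y‖) • y - (R / ‖z‖) • z
      = (R / ‖y‖) • (y - z) + (R / ‖y‖ * ((‖z‖ - ‖y‖) / ‖z‖)) • z := by
    have : R / ‖z‖ = R / ‖y‖ - R / ‖y‖ * ((‖z‖ - ‖y‖) / ‖z‖) := by field_simp; ring
    rw [this]
    module
  have h2 : |‖z‖ - ‖y‖| ≤ ‖y - z‖ := by
    rw [norm_sub_rev]
    exact abs_norm_sub_norm_le z y
  have h3 : R / ‖y‖ ≤ R / δ := by gcongr
  rw [dist_eq_norm, dist_eq_norm, h1]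
  calc _ ≤ ‖(R / ‖y‖) • (y - z)‖ + ‖(R / ‖y‖ * ((‖z‖ - ‖y‖) / ‖z‖)) • z‖ := norm_add_le _ _
    _ = R / ‖y‖ * ‖y - z‖ + R / ‖y‖ * |‖z‖ - ‖y‖| := by
      rw [norm_smul, norm_smul, norm_mul, norm_div, norm_div, norm_norm, norm_norm,
        Real.norm_eq_abs R, abs_of_pos hR, Real.norm_eq_abs]
      field_simp
    _ ≤ R / δ * ‖y - z‖ + R / δ * ‖y - z‖ := by gcongr
    _ = _ := by ring

variable [FiniteDimensional ℝ E]

/-- There is no Lipschitz retraction of a ball onto its boundary sphere: `x ↦ x + g x` is the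
identity outside the ball and has constant norm `R` inside. -/
theorem not_lipschitz_retraction {g : E → E} {C : NNReal} (hg : LipschitzWith C g) {R : ℝ}
    (hR : 0 < R) (hout : ∀ x, R ≤ ‖x‖ → g x = 0) (hin : ∀ x, ‖x‖ < R → ‖x + g x‖ = R) : False := by
  let _ : MeasurableSpace E := borel E
  have : BorelSpace E := ⟨rfl⟩
  -- Hausdorff measure in top dimension is a Haar measure for which Lipschitz maps visibly preserve
  -- null sets.
  let μ : Measure E := Measure.hausdorffMeasure (Module.finrank ℝ E)
  have : μ.IsAddHaarMeasure := isAddHaarMeasure_hausdorffMeasure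
  let U : Set E := Metric.ball 0 R
  let D : Set E := {x | DifferentiableAt ℝ g x}
  have hD : MeasurableSet D := measurableSet_of_differentiableAt ℝ g
  have hU : MeasurableSet U := measurableSet_ball
  have hDnull : μ Dᶜ = 0 := hg.ae_differentiableAt (μ := μ)
  have hUpos : 0 < μ.real U := by
    rw [measureReal_def]
    exact ENNReal.toReal_pos (Metric.measure_ball_pos μ 0 hR).ne' measure_ball_lt_top.ne
  -- positivity of the determinant for small `t`
  obtain ⟨δ, hδ, hdet⟩ : ∃ δ > 0, ∀ A : E →L[ℝ] E, ‖A‖ < δ → 0 < (1 + A).det := by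
    have hcont : ContinuousAt (fun A : E →L[ℝ] E => (1 + A).det) 0 :=
      (ContinuousLinearMap.continuous_det.comp (continuous_const.add continuous_id)).continuousAt
    have h1 : (0 : ℝ) < (1 + (0 : E →L[ℝ] E)).det := by
      rw [add_zero]
      have : (1 : E →L[ℝ] E).det = LinearMap.det (LinearMap.id : E →ₗ[ℝ] E) := rfl
      rw [this, LinearMap.det_id]
      exact one_pos
    obtain ⟨δ, hδ, h⟩ := Metric.eventually_nhds_iff.1 (hcont.eventually (lt_mem_nhds h1))
    exact ⟨δ, hδ, fun A hA => h (by simpa [dist_eq_norm] using hA)⟩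
  have hfd : ∀ x, ‖fderiv ℝ g x‖ ≤ C := fun x => norm_fderiv_le_of_lipschitz ℝ hg
  -- For `0 < t < ε`, `t C < 1` makes `x + t g x` bijective, and `t ‖Dg‖ < δ` makes its Jacobian
  -- positive.
  let ε : ℝ := min δ 1 / (C + 1)
  have hC1 : (0 : ℝ) < C + 1 := by positivity
  have hε : 0 < ε := by positivity
  have hsmall : ∀ t, 0 < t → t < ε →
      IntegrableOn (fun x => (1 + t • fderiv ℝ g x).det) (U ∩ D) μ ∧
        ∫ x in U ∩ D, (1 + t • fderiv ℝ g x).det ∂μ = μ.real U := by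
    intro t ht0 ht
    have htC : t * (C + 1) < min δ 1 := (lt_div_iff₀ hC1).1 ht
    have htC1 : t * C < 1 := by nlinarith [min_le_right δ 1]
    have hlip : LipschitzWith (t.toNNReal * C) fun x => t • g x := by
      refine LipschitzWith.of_dist_le_mul fun x y => ?_
      rw [dist_smul₀, Real.norm_of_nonneg ht0.le, NNReal.coe_mul, Real.coe_toNNReal _ ht0.le,
        mul_assoc]
      exact mul_le_mul_of_nonneg_left (hg.dist_le_mul x y) ht0.le
    have hlt : t.toNNReal * C < 1 := by
      rw [← NNReal.coe_lt_coe]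
      simpa [Real.coe_toNNReal _ ht0.le] using htC1
    have hbij := bijective_id_add_of_lipschitz hlip hlt
    set φ : E → E := fun x => x + t • g x with hφ
    have hφout : ∀ x, R ≤ ‖x‖ → φ x = x := fun x hx => by simp [hφ, hout x hx]
    -- A bijection that fixes every point outside the ball must permute the ball.
    have himg : φ '' U = U := by
      ext y
      constructor
      · rintro ⟨x, hx, rfl⟩
        by_contra hy
        have hy' : R ≤ ‖φ x‖ := by simpa [U] using hy
        have := hbij.1 (hφout _ hy')
        rw [this] at hy
        exact hy hx
      · intro hy
        obtain ⟨x, rfl⟩ := hbij.2 y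
        refine ⟨x, ?_, rfl⟩
        by_contra hx
        rw [hφout x (by simpa [U] using hx)] at hy
        exact hx hy
    have hφlip : LipschitzWith (1 + t.toNNReal * C) φ := LipschitzWith.id.add hlip
    have hnull : μ (φ '' Dᶜ) = 0 := by
      refine le_antisymm ?_ zero_le
      calc μ (φ '' Dᶜ) ≤ _ := hφlip.hausdorffMeasure_image_le (Nat.cast_nonneg _) _
        _ = 0 := by
          rw [show Measure.hausdorffMeasure (Module.finrank ℝ E : ℝ) Dᶜ = 0 from hDnull, mul_zero]
    have hmeas : μ.real (φ '' (U ∩ D)) = μ.real U := by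
      have h1 : U \ φ '' (U ∩ D) ⊆ φ '' Dᶜ := by
        rintro y ⟨hy, hy'⟩
        rw [← himg] at hy
        obtain ⟨x, hx, rfl⟩ := hy
        exact ⟨x, fun hxD => hy' ⟨x, ⟨hx, hxD⟩, rfl⟩, rfl⟩
      have h2 : φ '' (U ∩ D) ⊆ U := (Set.image_mono Set.inter_subset_left).trans himg.subset
      rw [measureReal_def, measureReal_def]
      congr 1
      refine le_antisymm (measure_mono h2) ?_
      calc μ U ≤ μ (φ '' (U ∩ D) ∪ φ '' Dᶜ) := measure_mono fun y hy => by
            by_cases h : y ∈ φ '' (U ∩ D)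
            · exact Or.inl h
            · exact Or.inr (h1 ⟨hy, h⟩)
        _ ≤ μ (φ '' (U ∩ D)) + μ (φ '' Dᶜ) := measure_union_le _ _
        _ = μ (φ '' (U ∩ D)) := by rw [hnull, add_zero]
    have hderiv : ∀ x ∈ U ∩ D,
        HasFDerivWithinAt φ (1 + t • fderiv ℝ g x) (U ∩ D) x := fun x hx =>
      ((hasFDerivAt_id x).add (hx.2.hasFDerivAt.const_smul t)).hasFDerivWithinAt
    have hcv := integral_image_eq_integral_abs_det_fderiv_smul μ (hU.inter hD) hderiv
      hbij.1.injOn (fun _ => (1 : ℝ))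
    have habs : ∀ x, |(1 + t • fderiv ℝ g x).det| = (1 + t • fderiv ℝ g x).det := fun x => by
      refine abs_of_pos (hdet _ ?_)
      rw [norm_smul, Real.norm_of_nonneg ht0.le]
      nlinarith [min_le_left δ 1, hfd x, norm_nonneg (fderiv ℝ g x)]
    simp only [habs, smul_eq_mul, mul_one, integral_const, MeasurableSet.univ,
      measureReal_restrict_apply, Set.univ_inter, hmeas] at hcv
    refine ⟨?_, hcv.symm⟩
    -- Integrability comes for free: a non-integrable function has integral 0 by convention, but
    -- this one has integral `μ.real U > 0`.
    by_contra hni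
    rw [integral_undef hni] at hcv
    exact hUpos.ne' hcv
  obtain ⟨t, c, ht, hc, hp⟩ := exists_extrapolation (Module.finrank ℝ E) hε
  have hone : ∀ x ∈ U ∩ D, (1 + fderiv ℝ g x).det = 0 := by
    rintro x ⟨hx, hxD⟩
    have hf : HasFDerivAt (fun y => y + g y) (1 + fderiv ℝ g x) x :=
      (hasFDerivAt_id x).add hxD.hasFDerivAt
    have hn : HasFDerivAt (fun y => ‖y + g y‖ ^ 2) _ x := hf.norm_sq
    have hev : (fun y => ‖y + g y‖ ^ 2) =ᶠ[nhds x] fun _ => R ^ 2 := by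
      filter_upwards [Metric.isOpen_ball.mem_nhds hx] with y hy
      rw [hin y (by simpa using hy)]
    have h0 := hn.unique ((hasFDerivAt_const (R ^ 2) x).congr_of_eventuallyEq hev)
    by_contra hne
    -- The squared norm of `f y = y + g y` is locally constant, so `f x` is orthogonal to the range
    -- of `Df`. If `Df` were onto, `f x` would be orthogonal to itself, although its norm is `R >
    -- 0`.
    have hsurj : Function.Surjective (1 + fderiv ℝ g x : E →L[ℝ] E) := by
      have hu : IsUnit (LinearMap.det ((1 + fderiv ℝ g x : E →L[ℝ] E) : E →ₗ[ℝ] E)) :=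
        isUnit_iff_ne_zero.2 hne
      exact (LinearEquiv.ofIsUnitDet (v := Module.finBasis ℝ E) (v' := Module.finBasis ℝ E)
        (by rwa [LinearMap.det_toMatrix])).surjective
    obtain ⟨v, hv⟩ := hsurj (x + g x)
    have h1 := congrArg (fun L : E →L[ℝ] ℝ => L v) h0
    have hxn := hin x (by simpa [U] using hx)
    have h2 : (2 : ℝ) * ‖x + g x‖ ^ 2 = 0 := by
      rw [← real_inner_self_eq_norm_sq]
      conv_lhs => rw [← hv]
      rw [hv]
      simpa only [two_smul, add_apply, ContinuousLinearMap.comp_apply, hv,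
        innerSL_apply_apply, zero_apply, two_mul] using h1
    rw [hxn] at h2
    exact hR.ne' (by simpa using h2)
  have hsum : ∫ x in U ∩ D, (1 + fderiv ℝ g x).det ∂μ = μ.real U := by
    -- Nodes and weights do not depend on `x`, so the extrapolation to `t = 1` can be integrated
    -- termwise.
    have heq : ∀ x, (1 + fderiv ℝ g x).det = ∑ j, c j * (1 + t j • fderiv ℝ g x).det := by
      intro x
      obtain ⟨p, hpd, hpe⟩ := exists_polynomial_det_one_add_smul (fderiv ℝ g x)
      have := hp p hpd
      simpa only [hpe, one_smul] using this
    simp_rw [heq]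
    rw [integral_finsetSum _ fun j _ => ((hsmall (t j) (ht j).1 (ht j).2).1.const_mul _)]
    simp_rw [integral_const_mul, fun j => (hsmall (t j) (ht j).1 (ht j).2).2]
    rw [← Finset.sum_mul, hc, one_mul]
  rw [setIntegral_congr_fun (hU.inter hD) hone] at hsum
  simp at hsum
  exact hUpos.ne hsum

/-- **Brouwer's fixed point theorem** for Lipschitz maps. -/
theorem exists_fixedPoint_of_lipschitzOn {K : Set E} (hne : K.Nonempty) (hK : IsCompact K)
    (hconv : Convex ℝ K) {h : E → E} {C : NNReal} (hh : LipschitzOnWith C h K)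
    (hmaps : Set.MapsTo h K K) : ∃ x ∈ K, h x = x := by
  obtain ⟨π, hπ, hπK, hπid, -⟩ := exists_lipschitz_projection hne hK.isComplete hconv
  obtain ⟨R₀, hR₀, hKR⟩ := hK.isBounded.exists_pos_norm_le
  by_contra! hfix
  set H : E → E := fun x => h (π x) with hH
  have hHK : ∀ x, H x ∈ K := fun x => hmaps (hπK x)
  have hHfix : ∀ x, H x ≠ x := fun x hx => by
    have hxK : x ∈ K := hx ▸ hHK x
    refine hfix x hxK ?_
    simpa [hH, hπid x hxK] using hx
  have hHlip : ∀ x y, ‖H x - H y‖ ≤ C * ‖x - y‖ := fun x y => by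
    have h1 := hh.dist_le_mul _ (hπK x) _ (hπK y)
    have h2 := hπ.dist_le_mul x y
    rw [NNReal.coe_one, one_mul] at h2
    rw [← dist_eq_norm, ← dist_eq_norm]
    exact h1.trans (by gcongr)
  -- The cutoff is 1 for `‖x‖ ≤ R₀` and 0 for `‖x‖ ≥ 2 R₀`. A zero of `x - χ x • H x` has norm at
  -- most `R₀`, hence would be a fixed point of `H`.
  set χ : E → ℝ := fun x => max (min 1 (2 - ‖x‖ / R₀)) 0 with hχ
  have hχ0 : ∀ x, 0 ≤ χ x := fun x => le_max_right _ _
  have hχ1 : ∀ x, χ x ≤ 1 := fun x => max_le (min_le_left _ _) zero_le_one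
  have hχlip : ∀ x y, |χ x - χ y| ≤ ‖x - y‖ / R₀ := fun x y => by
    have h1 : |χ x - χ y| ≤ |‖x‖ / R₀ - ‖y‖ / R₀| := by
      refine (abs_max_sub_max_le_abs _ _ _).trans ((abs_min_sub_min_le_max _ _ _ _).trans ?_)
      rw [sub_self, abs_zero, sub_sub_sub_cancel_left, abs_sub_comm]
      exact max_le (abs_nonneg _) le_rfl
    rw [← sub_div, abs_div, abs_of_pos hR₀] at h1
    exact h1.trans (by gcongr; exact abs_norm_sub_norm_le x y)
  set R : ℝ := 2 * R₀ with hR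
  have hRpos : 0 < R := by positivity
  set F : E → E := fun x => x - χ x • H x with hF
  have hF0 : ∀ x, F x ≠ 0 := fun x hx => by
    have hx' : x = χ x • H x := sub_eq_zero.1 hx
    have hn : ‖x‖ ≤ R₀ := by
      rw [hx', norm_smul, Real.norm_of_nonneg (hχ0 x)]
      nlinarith [hχ0 x, hχ1 x, hKR _ (hHK x), norm_nonneg (H x)]
    have h1 : χ x = 1 := by
      have : ‖x‖ / R₀ ≤ 1 := (div_le_one hR₀).2 hn
      simp only [hχ]
      rw [min_eq_left (by linarith), max_eq_left zero_le_one]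
    rw [h1, one_smul] at hx'
    exact hHfix x hx'.symm
  have hFout : ∀ x, R ≤ ‖x‖ → F x = x := fun x hx => by
    have : 2 ≤ ‖x‖ / R₀ := (le_div_iff₀ hR₀).2 hx
    have h0 : χ x = 0 := max_eq_right ((min_le_right _ _).trans (by linarith))
    simp [hF, h0]
  have hFlip : LipschitzWith (1 + (C + 1)) F := by
    refine LipschitzWith.of_dist_le_mul fun x y => ?_
    rw [dist_eq_norm, dist_eq_norm]
    have h1 : F x - F y = (x - y) - (χ x • (H x - H y) + (χ x - χ y) • H y) := by
      simp only [hF]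
      module
    have h2 : ‖χ x • (H x - H y)‖ ≤ C * ‖x - y‖ := by
      rw [norm_smul, Real.norm_of_nonneg (hχ0 x)]
      exact (mul_le_of_le_one_left (norm_nonneg _) (hχ1 x)).trans (hHlip x y)
    have h3 : ‖(χ x - χ y) • H y‖ ≤ ‖x - y‖ := by
      rw [norm_smul, Real.norm_eq_abs]
      calc _ ≤ ‖x - y‖ / R₀ * R₀ := by
            gcongr
            · exact hχlip x y
            · exact hKR _ (hHK y)
        _ = _ := by field_simp
    rw [h1]
    push_cast
    linarith [norm_sub_le (x - y) (χ x • (H x - H y) + (χ x - χ y) • H y),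
      norm_add_le (χ x • (H x - H y)) ((χ x - χ y) • H y)]
  obtain ⟨δ, hδ, hFδ⟩ : ∃ δ > 0, ∀ x ∈ Metric.closedBall (0 : E) R, δ ≤ ‖F x‖ := by
    obtain ⟨x₀, -, hx₀⟩ := (isCompact_closedBall (0 : E) R).exists_isMinOn
      ⟨0, by simp [hRpos.le]⟩ hFlip.continuous.norm.continuousOn
    exact ⟨‖F x₀‖, norm_pos_iff.2 (hF0 x₀), fun x hx => hx₀ hx⟩
  obtain ⟨ρ, hρ, hρB, hρid, hρin⟩ := exists_lipschitz_projection
    (K := Metric.closedBall (0 : E) R) ⟨0, by simp [hRpos.le]⟩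
    (isCompact_closedBall (0 : E) R).isComplete (convex_closedBall 0 R)
  have hρout : ∀ x, R ≤ ‖x‖ → ‖ρ x‖ = R := by
    intro x hx
    have hq : ‖ρ x‖ ≤ R := by simpa using hρB x
    have hx0 : 0 < ‖x‖ := hRpos.trans_le hx
    -- Testing with the radial projection gives `(‖x‖ - ‖ρ x‖) (R - ‖ρ x‖) ≤ 0`, which excludes `‖ρ
    -- x‖ < R`.
    have h1 := hρin x ((R / ‖x‖) • x) (by
      rw [mem_closedBall_zero_iff, norm_smul, norm_div, norm_norm, Real.norm_of_nonneg hRpos.le]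
      field_simp
      rfl)
    rw [inner_sub_left, inner_sub_right, inner_sub_right, inner_smul_right, inner_smul_right,
      real_inner_self_eq_norm_sq, real_inner_self_eq_norm_sq, real_inner_comm x (ρ x)] at h1
    have h2 := real_inner_le_norm x (ρ x)
    have h3 : R / ‖x‖ * ‖x‖ ^ 2 = R * ‖x‖ := by field_simp
    have h4 : R / ‖x‖ * inner ℝ x (ρ x) ≤ R * ‖ρ x‖ := by
      calc _ ≤ R / ‖x‖ * (‖x‖ * ‖ρ x‖) := by gcongr
        _ = _ := by field_simp
    nlinarith
  set f : E → E := fun x => (R / ‖F x‖) • F x with hf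
  have hfn : ∀ x, ‖f x‖ = R := fun x => by
    have := norm_pos_iff.2 (hF0 x)
    rw [hf, norm_smul, norm_div, norm_norm, Real.norm_of_nonneg hRpos.le]
    field_simp
  have hfs : ∀ x, ‖x‖ = R → f x = x := fun x hx => by
    simp only [hf, hFout x hx.ge, hx]
    rw [div_self hRpos.ne', one_smul]
  -- Composing with `ρ` keeps the argument of `F` in the ball, where `‖F‖ ≥ δ` and normalization is
  -- Lipschitz.
  have hglip : LipschitzWith (Real.toNNReal (2 * R / δ) * (1 + (C + 1)) + 1)
      fun x => f (ρ x) - ρ x := by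
    refine LipschitzWith.sub ?_ hρ
    refine LipschitzWith.of_dist_le_mul fun x y => ?_
    refine (dist_normalize_le hRpos hδ (hFδ _ (hρB x)) (hFδ _ (hρB y))).trans ?_
    rw [NNReal.coe_mul, Real.coe_toNNReal _ (by positivity), mul_assoc]
    have h1 := hFlip.dist_le_mul (ρ x) (ρ y)
    have h2 := hρ.dist_le_mul x y
    rw [NNReal.coe_one, one_mul] at h2
    gcongr
    exact h1.trans (by gcongr)
  refine not_lipschitz_retraction hglip hRpos (fun x hx => ?_) fun x hx => ?_
  · rw [hfs _ (hρout x hx), sub_self]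
  · rw [hρid x (by simpa using hx.le), add_sub_cancel, hfn]

end LipschitzFixedPoint

/-! ### Convex polytopes and sets of zero `(d-1)`-dimensional measure -/

section Polytopes

variable {d : ℕ}

theorem IsOpenPolytope.isOpen {P : Set (EuclideanSpace ℝ (Fin d))} (hP : IsOpenPolytope P) :
    IsOpen P := by
  obtain ⟨-, -, H, rfl⟩ := hP
  have : {x : EuclideanSpace ℝ (Fin d) | ∀ h ∈ H, inner ℝ h.1 x < h.2}
      = ⋂ h ∈ H, {x | inner ℝ h.1 x < h.2} := by
    ext x
    simp
  rw [this]
  exact isOpen_biInter_finset fun h _ =>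
    isOpen_lt (continuous_const.inner continuous_id) continuous_const

theorem IsOpenPolytope.convex {P : Set (EuclideanSpace ℝ (Fin d))} (hP : IsOpenPolytope P) :
    Convex ℝ P := by
  obtain ⟨-, -, H, rfl⟩ := hP
  have : {x : EuclideanSpace ℝ (Fin d) | ∀ h ∈ H, inner ℝ h.1 x < h.2}
      = ⋂ h ∈ H, {x | inner ℝ h.1 x < h.2} := by
    ext x
    simp
  rw [this]
  exact convex_iInter₂ fun h _ => convex_halfSpace_lt (innerₛₗ ℝ h.1).isLinear h.2

theorem IsPolyhedralDomain.isOpen {Ω : Set (EuclideanSpace ℝ (Fin d))}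
    (hΩ : IsPolyhedralDomain Ω) : IsOpen Ω := by
  obtain ⟨-, S, -, -, rfl⟩ := hΩ
  exact isOpen_interior

theorem IsPolyhedralDomain.isBounded {Ω : Set (EuclideanSpace ℝ (Fin d))}
    (hΩ : IsPolyhedralDomain Ω) : Bornology.IsBounded Ω := by
  obtain ⟨-, S, hS, hP, rfl⟩ := hΩ
  refine Bornology.IsBounded.subset ?_ interior_subset
  exact (Bornology.isBounded_biUnion hS).2 fun P h => (hP P h).2.1.closure

/-- A bounded subset of a hyperplane has finite `(d-1)`-dimensional measure. -/
theorem euclideanHausdorffMeasure_lt_top_of_hyperplane {s : Set (EuclideanSpace ℝ (Fin d))}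
    (hs : Bornology.IsBounded s) {a : EuclideanSpace ℝ (Fin d)} (ha : a ≠ 0) {b : ℝ}
    (hab : ∀ x ∈ s, inner ℝ a x = b) :
    (μHE[d - 1] : Measure (EuclideanSpace ℝ (Fin d))) s < ⊤ := by
  rcases s.eq_empty_or_nonempty with rfl | ⟨x₀, hx₀⟩
  · simp
  let S : Submodule ℝ (EuclideanSpace ℝ (Fin d)) := (ℝ ∙ a)ᗮ
  have hS : Module.finrank ℝ S = d - 1 := by
    have h1 := Submodule.finrank_add_finrank_orthogonal (ℝ ∙ a)
    rw [finrank_span_singleton ha, finrank_euclideanSpace_fin] at h1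
    have : Module.finrank ℝ S = Module.finrank ℝ (ℝ ∙ a)ᗮ := rfl
    omega
  -- The hyperplane is an isometric copy of the `(d-1)`-dimensional space `aᗮ`, where the measure is
  -- Lebesgue measure.
  let ι : S → EuclideanSpace ℝ (Fin d) := fun v => x₀ + v
  have hι : Isometry ι := (IsometryEquiv.addLeft x₀).isometry.comp isometry_subtype_coe
  have himg : s = ι '' (ι ⁻¹' s) := by
    refine (Set.image_preimage_eq_of_subset fun x hx => ?_).symm
    refine ⟨⟨x - x₀, ?_⟩, by simp [ι]⟩
    rw [Submodule.mem_orthogonal_singleton_iff_inner_right, inner_sub_right, hab x hx,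
      hab x₀ hx₀, sub_self]
  rw [himg, hι.euclideanHausdorffMeasure_image, ← hS,
    InnerProductSpace.euclideanHausdorffMeasure_eq_volume]
  exact (hι.antilipschitz.isBounded_preimage hs).measure_lt_top

/-- A closed set of zero `(d-1)`-dimensional measure does not separate a convex open set. -/
theorem false_of_separated_by_null {C₁ C₂ V U₁ U₂ : Set (EuclideanSpace ℝ (Fin d))}
    (h₁ : IsClosed C₁) (h₂ : IsClosed C₂) (hV : IsOpen V) (hVc : Convex ℝ V) (hVC : V ⊆ C₁ ∪ C₂)
    (hnull : (μHE[d - 1] : Measure (EuclideanSpace ℝ (Fin d))) (C₁ ∩ C₂) = 0)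
    (hU₁ : IsOpen U₁) (hU₂ : IsOpen U₂) (hUC₁ : U₁ ⊆ C₁) (hUC₂ : U₂ ⊆ C₂)
    (hdisj : Disjoint U₁ U₂) (hne₁ : (U₁ ∩ V).Nonempty) (hne₂ : (U₂ ∩ V).Nonempty) : False := by
  obtain ⟨a, ha⟩ := hne₁
  obtain ⟨b, hb⟩ := hne₂
  obtain ⟨ε₁, hε₁, hball₁⟩ := Metric.isOpen_iff.1 (hU₁.inter hV) a ha
  obtain ⟨ε₂, hε₂, hball₂⟩ := Metric.isOpen_iff.1 (hU₂.inter hV) b hb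
  set w := b - a with hw
  have hw0 : w ≠ 0 := by
    intro h
    rw [sub_eq_zero.1 h] at hb
    exact Set.disjoint_left.1 hdisj ha.1 hb.1
  let S : Submodule ℝ (EuclideanSpace ℝ (Fin d)) := (ℝ ∙ w)ᗮ
  have hS : Module.finrank ℝ S = d - 1 := by
    have h1 := Submodule.finrank_add_finrank_orthogonal (ℝ ∙ w)
    rw [finrank_span_singleton hw0, finrank_euclideanSpace_fin] at h1
    have : Module.finrank ℝ S = Module.finrank ℝ (ℝ ∙ w)ᗮ := rfl
    omega
  let P := S.orthogonalProjectionOnto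
  have hPw : P w = 0 :=
    Submodule.orthogonalProjectionOnto_orthogonal_apply_eq_zero
      (Submodule.mem_span_singleton_self w)
  have hPnull : (volume : Measure S) (P '' (C₁ ∩ C₂)) = 0 := by
    rw [← InnerProductSpace.euclideanHausdorffMeasure_eq_volume, hS,
      Measure.euclideanHausdorffMeasure_def, Measure.smul_apply]
    rw [Measure.euclideanHausdorffMeasure_def, Measure.smul_apply] at hnull
    have h0 : Measure.hausdorffMeasure ((d - 1 : ℕ) : ℝ) (C₁ ∩ C₂) = 0 := by
      simpa [Measure.addHaarScalarFactor_volume_hausdorffMeasure_ne_zero] using hnull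
    have h1 := hausdorffMeasure_orthogonalProjectionOnto_le S ((d - 1 : ℕ) : ℝ) (C₁ ∩ C₂)
      (Nat.cast_nonneg _)
    rw [h0] at h1
    rw [le_antisymm h1 zero_le, smul_zero]
  -- The shadow of `C₁ ∩ C₂` along `w` is null in `wᗮ`, so the segment from `a` to `b` can be
  -- shifted slightly, parallel to itself, to miss `C₁ ∩ C₂`. Connectedness of the shifted segment
  -- is then contradicted.
  obtain ⟨s, hs, hsP⟩ : ∃ s ∈ Metric.ball (P a) (min ε₁ ε₂), s ∉ P '' (C₁ ∩ C₂) := by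
    by_contra! h
    have h1 : (volume : Measure S) (Metric.ball (P a) (min ε₁ ε₂)) ≤ 0 :=
      hPnull ▸ measure_mono h
    exact (Metric.measure_ball_pos volume (P a) (lt_min hε₁ hε₂)).not_ge h1
  let a' : EuclideanSpace ℝ (Fin d) := a + ((s - P a : S) : EuclideanSpace ℝ (Fin d))
  let b' : EuclideanSpace ℝ (Fin d) := a' + w
  have hsn : ‖((s - P a : S) : EuclideanSpace ℝ (Fin d))‖ < min ε₁ ε₂ := by
    rw [Metric.mem_ball, dist_eq_norm] at hs
    exact hs
  have ha' : a' ∈ U₁ ∩ V := hball₁ (by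
    rw [Metric.mem_ball, dist_eq_norm, add_sub_cancel_left]
    exact hsn.trans_le (min_le_left _ _))
  have hb' : b' ∈ U₂ ∩ V := hball₂ (by
    rw [Metric.mem_ball, dist_eq_norm,
      show b' - b = ((s - P a : S) : EuclideanSpace ℝ (Fin d)) by simp only [b', a', hw]; abel]
    exact hsn.trans_le (min_le_right _ _))
  have hseg : segment ℝ a' b' ⊆ V := hVc.segment_subset ha'.2 hb'.2
  obtain ⟨x, hx, hxC⟩ := isPreconnected_closed_iff.1 (convex_segment a' b').isPreconnected C₁ C₂
    h₁ h₂ (hseg.trans hVC) ⟨a', left_mem_segment ℝ _ _, hUC₁ ha'.1⟩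
    ⟨b', right_mem_segment ℝ _ _, hUC₂ hb'.1⟩
  refine hsP ⟨x, hxC, ?_⟩
  rw [segment_eq_image'] at hx
  obtain ⟨t, -, rfl⟩ := hx
  simp only [b', a', add_sub_cancel_left, map_add, map_smul, hPw, smul_zero, add_zero]
  have : P ((s - P a : S) : EuclideanSpace ℝ (Fin d)) = s - P a :=
    Submodule.orthogonalProjectionOnto_mem_subspace_eq_self _
  rw [this]
  abel

end Polytopes

/-! ### Geometry of the mesh and connectedness of the cell graph -/

namespace AdmissibleMesh

variable {d : ℕ} {Ω : Set (EuclideanSpace ℝ (Fin d))} (M : AdmissibleMesh Ω)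

theorem isOpen_cell (K : M.Cell) : IsOpen (M.cell K) := (M.cell_polytope K).isOpen

theorem cellMeas_pos (K : M.Cell) : 0 < M.cellMeas K := by
  rw [cellMeas, measureReal_def]
  exact ENNReal.toReal_pos ((M.isOpen_cell K).measure_pos volume (M.cell_polytope K).1).ne'
    (M.cell_polytope K).2.1.measure_lt_top.ne

/-- Finiteness matters here, because `Measure.real` sends infinite measure to 0; it holds since the
edge is a bounded part of a hyperplane. -/
theorem edgeMeas_pos (hΩ : Bornology.IsBounded Ω) (σ : M.Edge) : 0 < M.edgeMeas σ := by
  obtain ⟨a, ha, b, hb⟩ := M.edge_hyperplane σ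
  rw [edgeMeas, measureReal_def]
  exact ENNReal.toReal_pos (M.edge_pos σ).ne' (euclideanHausdorffMeasure_lt_top_of_hyperplane
    (hΩ.closure.subset (M.edge_subset σ)) ha hb).ne

theorem trans_nonneg (σ : M.Edge) : 0 ≤ M.trans σ := by
  refine div_nonneg measureReal_nonneg ?_
  rw [edgeDist]
  split_ifs
  · exact Metric.infDist_nonneg
  · exact dist_nonneg

theorem trans_pos (hΩ : Bornology.IsBounded Ω) {K L : M.Cell} (hKL : K ≠ L) {σ : M.Edge}
    (hK : σ ∈ M.edges K) (hL : σ ∈ M.edges L) : 0 < M.trans σ := by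
  refine div_pos (M.edgeMeas_pos hΩ σ) ?_
  have hb : ¬ M.edge σ ⊆ frontier Ω := fun hb =>
    hKL ((M.boundary_edge σ hb).unique hK hL)
  rw [edgeDist, if_neg hb]
  refine dist_pos.2 ?_
  obtain ⟨N, hN, hσN⟩ : ∃ N, M.side σ ≠ N ∧ σ ∈ M.edges N := by
    by_cases h : M.side σ = K
    · exact ⟨L, h ▸ hKL, hL⟩
    · exact ⟨K, h, hK⟩
  rw [M.opp_of_interior hN (M.side_mem σ) hσN]
  exact M.center_ne _ _ hN σ (M.side_mem σ) hσN

theorem closure_eq_iUnion : closure Ω = ⋃ K, closure (M.cell K) := by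
  rw [← M.closure_cells, closure_iUnion_of_finite]

/-- The graph of cells, with neighbors sharing an edge, is connected. -/
theorem eq_univ_of_neighbor_closed (hΩ : IsPolyhedralDomain Ω) {S : Set M.Cell}
    (hne : S.Nonempty)
    (hS : ∀ K ∈ S, ∀ L, K ≠ L → ∀ σ, σ ∈ M.edges K → σ ∈ M.edges L → L ∈ S) :
    S = Set.univ := by
  by_contra hun
  obtain ⟨L₀, hL₀⟩ := (Set.ne_univ_iff_exists_notMem S).1 hun
  obtain ⟨K₀, hK₀⟩ := hne
  have hclosed : ∀ A : Set M.Cell, IsClosed (⋃ K ∈ A, closure (M.cell K)) := fun A =>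
    A.toFinite.isClosed_biUnion fun _ _ => isClosed_closure
  have hsub : ∀ (A : Set M.Cell), ∀ K ∈ A, M.cell K ⊆ ⋃ K ∈ A, closure (M.cell K) :=
    fun A K hK => subset_closure.trans
      (Set.subset_biUnion_of_mem (u := fun K => closure (M.cell K)) hK)
  have hcov : Ω ⊆ (⋃ K ∈ S, closure (M.cell K)) ∪ ⋃ K ∈ Sᶜ, closure (M.cell K) := by
    intro x hx
    have := subset_closure hx
    rw [M.closure_eq_iUnion] at this
    obtain ⟨K, hK⟩ := Set.mem_iUnion.1 this
    by_cases h : K ∈ S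
    · exact Or.inl (Set.mem_biUnion h hK)
    · exact Or.inr (Set.mem_biUnion (show K ∈ Sᶜ from h) hK)
  have hmeet : ∀ (A : Set M.Cell), ∀ K ∈ A, (Ω ∩ ⋃ K ∈ A, closure (M.cell K)).Nonempty := by
    intro A K hK
    obtain ⟨x, hx⟩ := (M.cell_polytope K).1
    exact ⟨x, M.cell_subset K hx, hsub A K hK hx⟩
  -- If `S` were a proper subset, connectedness of `Ω` would give a point of `Ω` common to both
  -- groups of closed cells; a ball around it is then separated by their intersection.
  obtain ⟨z, hzΩ, hz₁, hz₂⟩ := isPreconnected_closed_iff.1 hΩ.1.isPreconnected _ _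
    (hclosed S) (hclosed Sᶜ) hcov (hmeet S K₀ hK₀) (hmeet Sᶜ L₀ hL₀)
  obtain ⟨r, hr, hball⟩ := Metric.isOpen_iff.1 hΩ.isOpen z hzΩ
  simp only [Set.mem_iUnion, exists_prop] at hz₁ hz₂
  obtain ⟨K, hKS, hzK⟩ := hz₁
  obtain ⟨L, hLS, hzL⟩ := hz₂
  -- A cell of `S` and a cell of `Sᶜ` share no edge, as `S` is closed under neighbors; so only the
  -- null alternative of `cell_inter` remains.
  have hnull : (μHE[d - 1] : Measure (EuclideanSpace ℝ (Fin d)))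
      ((⋃ K ∈ S, closure (M.cell K)) ∩ ⋃ K ∈ Sᶜ, closure (M.cell K)) = 0 := by
    refine measure_mono_null (t := ⋃ p : S × (Sᶜ : Set M.Cell),
      closure (M.cell p.1) ∩ closure (M.cell p.2)) ?_ (measure_iUnion_null fun p => ?_)
    · rintro x ⟨hx₁, hx₂⟩
      simp only [Set.mem_iUnion, exists_prop] at hx₁ hx₂
      obtain ⟨K', hK', hxK'⟩ := hx₁
      obtain ⟨L', hL', hxL'⟩ := hx₂
      exact Set.mem_iUnion.2 ⟨⟨⟨K', hK'⟩, ⟨L', hL'⟩⟩, hxK', hxL'⟩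
    · have hne : (p.1 : M.Cell) ≠ p.2 := fun h => p.2.2 (h ▸ p.1.2)
      refine (M.cell_inter p.1 p.2 hne).resolve_right ?_
      rintro ⟨σ, hσ₁, hσ₂, -⟩
      exact p.2.2 (hS _ p.1.2 _ hne σ hσ₁ hσ₂)
  have hz : z ∈ Metric.ball z r := Metric.mem_ball_self hr
  refine false_of_separated_by_null (hclosed S) (hclosed Sᶜ) Metric.isOpen_ball (convex_ball z r)
    (hball.trans hcov) hnull (M.isOpen_cell K) (M.isOpen_cell L) (hsub S K hKS) (hsub Sᶜ L hLS)
    (M.cell_disjoint K L fun h => hLS (h ▸ hKS)) ?_ ?_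
  · rw [Set.inter_comm]
    exact mem_closure_iff.1 hzK _ Metric.isOpen_ball hz
  · rw [Set.inter_comm]
    exact mem_closure_iff.1 hzL _ Metric.isOpen_ball hz

/-- Points of `Ω` outside all cells lie on cell boundaries, and the frontier of a convex set is
Lebesgue-null. -/
theorem ae_eq_iUnion_cell : (Ω : Set (EuclideanSpace ℝ (Fin d))) =ᵐ[volume] ⋃ K, M.cell K := by
  refine (ae_eq_set.2 ⟨?_, ?_⟩)
  · refine measure_mono_null (t := ⋃ K, frontier (M.cell K)) ?_ (measure_iUnion_null fun K =>
      (M.cell_polytope K).convex.addHaar_frontier volume)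
    rintro x ⟨hx, hxc⟩
    have := subset_closure hx
    rw [M.closure_eq_iUnion] at this
    obtain ⟨K, hK⟩ := Set.mem_iUnion.1 this
    refine Set.mem_iUnion.2 ⟨K, hK, fun h => hxc (Set.mem_iUnion.2 ⟨K, interior_subset h⟩)⟩
  · rw [Set.sdiff_eq_empty.2 (Set.iUnion_subset M.cell_subset), measure_empty]

theorem setIntegral_eq_sum {f : EuclideanSpace ℝ (Fin d) → ℝ}
    (hf : ∀ K, IntegrableOn f (M.cell K)) :
    ∫ x in Ω, f x = ∑ K, ∫ x in M.cell K, f x := by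
  rw [setIntegral_congr_set M.ae_eq_iUnion_cell]
  exact integral_iUnion_fintype (fun K => (M.isOpen_cell K).measurableSet)
    (fun K L h => M.cell_disjoint K L h) hf

theorem pc_eq (v : M.Cell → ℝ) {K : M.Cell} {x : EuclideanSpace ℝ (Fin d)} (hx : x ∈ M.cell K) :
    M.pc v x = v K := by
  classical
  rw [pc, Finset.sum_eq_single K]
  · exact Set.indicator_of_mem hx _
  · intro L _ hL
    exact Set.indicator_of_notMem (fun h => Set.disjoint_left.1 (M.cell_disjoint L K hL) h hx) _
  · simp

/-- The integral of a function of the cell values. -/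
theorem setIntegral_pc {n : ℕ} (G : (Fin n → ℝ) → ℝ) (u : Fin n → M.Cell → ℝ) :
    ∫ x in Ω, G (fun i => M.pc (u i) x) = ∑ K, M.cellMeas K * G (fun i => u i K) := by
  have heq : ∀ K, Set.EqOn (fun x => G (fun i => M.pc (u i) x)) (fun _ => G (fun i => u i K))
      (M.cell K) := fun K x hx => by
    simp only [M.pc_eq _ hx]
  have hmeas : ∀ K, MeasurableSet (M.cell K) := fun K => (M.isOpen_cell K).measurableSet
  rw [M.setIntegral_eq_sum fun K => (integrableOn_congr_fun (heq K) (hmeas K)).2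
    (integrableOn_const (M.cell_polytope K).2.1.measure_lt_top.ne)]
  refine Finset.sum_congr rfl fun K _ => ?_
  rw [setIntegral_congr_fun (hmeas K) (heq K), setIntegral_const, smul_eq_mul, cellMeas]

end AdmissibleMesh

/-! ### Discrete integration by parts, conservativity and positivity -/

namespace AdmissibleMesh

variable {d n : ℕ} {Ω : Set (EuclideanSpace ℝ (Fin d))} (M : AdmissibleMesh Ω)

/-- On boundary edges the two alternatives coincide, so later arguments treat interior and boundary
edges alike. -/
theorem mem_edges_iff {K : M.Cell} {σ : M.Edge} (hK : σ ∈ M.edges K) (L : M.Cell) :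
    σ ∈ M.edges L ↔ L = K ∨ L = M.opp K σ := by
  by_cases hb : M.edge σ ⊆ frontier Ω
  · rw [M.opp_of_boundary hb hK, or_self]
    exact ⟨fun hL => (M.boundary_edge σ hb).unique hL hK, fun h => h ▸ hK⟩
  · obtain ⟨K', L', hne, -, hM⟩ := M.interior_edge σ hb
    rcases (hM K).1 hK with rfl | rfl
    · rw [M.opp_of_interior hne hK ((hM L').2 (Or.inr rfl)), hM]
    · rw [M.opp_of_interior hne.symm hK ((hM K').2 (Or.inl rfl)), hM, or_comm]

theorem opp_mem {K : M.Cell} {σ : M.Edge} (hK : σ ∈ M.edges K) : σ ∈ M.edges (M.opp K σ) :=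
  (M.mem_edges_iff hK _).2 (Or.inr rfl)

theorem opp_opp {K : M.Cell} {σ : M.Edge} (hK : σ ∈ M.edges K) : M.opp (M.opp K σ) σ = K := by
  by_cases h : M.opp K σ = K
  · rw [h, h]
  · exact M.opp_of_interior h (M.opp_mem hK) hK

theorem jump_opp (v : M.Cell → ℝ) {K : M.Cell} {σ : M.Edge} (hK : σ ∈ M.edges K) :
    M.jump v (M.opp K σ) σ = -M.jump v K σ := by
  rw [jump, jump, M.opp_opp hK, neg_sub]

/-- Discrete integration by parts. -/
theorem sum_mul_eq_neg_sum_jump (q : M.Cell → M.Edge → ℝ)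
    (hq : ∀ K, ∀ σ ∈ M.edges K, q (M.opp K σ) σ = -q K σ) (φ : M.Cell → ℝ) :
    ∑ K, (∑ σ ∈ M.edges K, q K σ) * φ K
      = -∑ σ, q (M.side σ) σ * M.jump φ (M.side σ) σ := by
  classical
  simp_rw [Finset.sum_mul]
  rw [Finset.sum_comm' (t' := Finset.univ) (s' := fun σ => Finset.univ.filter (σ ∈ M.edges ·))
    (by simp), ← Finset.sum_neg_distrib]
  refine Finset.sum_congr rfl fun σ _ => ?_
  have hs := M.side_mem σ
  have hfil : Finset.univ.filter (σ ∈ M.edges ·) = {M.side σ, M.opp (M.side σ) σ} := by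
    ext L
    simp [M.mem_edges_iff hs]
  have hqs := hq _ σ hs
  rw [hfil, jump]
  -- On a boundary edge, antisymmetry reads `q = -q`, hence `q = 0`: this is the no-flux condition.
  by_cases h : M.opp (M.side σ) σ = M.side σ
  · rw [h] at hqs ⊢
    have : q (M.side σ) σ = 0 := by linarith
    simp [this]
  · rw [Finset.sum_pair (Ne.symm h), hqs]
    ring

variable (B : Matrix (Fin n) (Fin n) ℝ) (u : Fin n → M.Cell → ℝ)

theorem jump_pressure (i : Fin n) (K : M.Cell) (σ : M.Edge) :
    M.jump (M.pressure B u i) K σ = ∑ j, B i j * M.jump (u j) K σ := by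
  simp only [jump, pressure, ← Finset.sum_sub_distrib, mul_sub]

/-- The convective part of the flux in terms of positive and negative parts. -/
theorem mobility_mul_jump (i : Fin n) (K : M.Cell) (σ : M.Edge) :
    M.mobility B u i K σ * M.jump (M.pressure B u i) K σ
      = u i (M.opp K σ) * max (M.jump (M.pressure B u i) K σ) 0
        - u i K * max (-M.jump (M.pressure B u i) K σ) 0 := by
  rw [mobility]
  split_ifs with h
  · rw [max_eq_left h, max_eq_right (by linarith)]
    ring
  · rw [max_eq_right (by linarith), max_eq_left (by linarith)]
    ring

/-- The mobility alone may differ between the two sides when the pressure jump is zero; its product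
with the jump does not see this tie. -/
theorem mobility_mul_jump_opp (i : Fin n) {K : M.Cell} {σ : M.Edge} (hK : σ ∈ M.edges K) :
    M.mobility B u i (M.opp K σ) σ * M.jump (M.pressure B u i) (M.opp K σ) σ
      = -(M.mobility B u i K σ * M.jump (M.pressure B u i) K σ) := by
  rw [mobility_mul_jump, mobility_mul_jump, M.opp_opp hK, M.jump_opp _ hK, neg_neg]
  ring

theorem flux_eq (η α : ℝ) (i : Fin n) (K : M.Cell) (σ : M.Edge) :
    M.flux η α B u i K σ = -(M.trans σ * (M.mobility B u i K σ * M.jump (M.pressure B u i) K σ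
      + η ^ α * M.jump (u i) K σ)) := by
  rw [flux]
  ring

theorem flux_opp (η α : ℝ) (i : Fin n) {K : M.Cell} {σ : M.Edge} (hK : σ ∈ M.edges K) :
    M.flux η α B u i (M.opp K σ) σ = -M.flux η α B u i K σ := by
  rw [flux_eq, flux_eq, M.mobility_mul_jump_opp B u i hK, M.jump_opp _ hK]
  ring

theorem sum_flux_eq_zero (η α : ℝ) (i : Fin n) :
    ∑ K, ∑ σ ∈ M.edges K, M.flux η α B u i K σ = 0 := by
  have := M.sum_mul_eq_neg_sum_jump (M.flux η α B u i) (fun K σ hK => M.flux_opp B u η α i hK)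
    fun _ => 1
  simpa [jump] using this

theorem mobility_nonneg {B u} (hu : ∀ i K, 0 ≤ u i K) (i : Fin n) (K : M.Cell) (σ : M.Edge) :
    0 ≤ M.mobility B u i K σ := by
  rw [mobility]
  split_ifs
  exacts [hu _ _, hu _ _]

section Step

variable {M B u} {v : Fin n → M.Cell → ℝ} {Δt η α : ℝ}

/-- The weak form of the scheme. -/
theorem IsStep.sum_mul (h : M.IsStep Δt η α B v u) (hΔt : 0 < Δt) (i : Fin n) (φ : M.Cell → ℝ) :
    ∑ K, M.cellMeas K * ((u i K - v i K) * φ K)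
      = -(Δt * ∑ σ, M.trans σ * (M.mobility B u i (M.side σ) σ *
          M.jump (M.pressure B u i) (M.side σ) σ + η ^ α * M.jump (u i) (M.side σ) σ)
          * M.jump φ (M.side σ) σ) := by
  have h1 := M.sum_mul_eq_neg_sum_jump (M.flux η α B u i)
    (fun K σ hK => M.flux_opp B u η α i hK) φ
  have h2 : ∀ K, M.cellMeas K * ((u i K - v i K) * φ K)
      = -Δt * ((∑ σ ∈ M.edges K, M.flux η α B u i K σ) * φ K) := by
    intro K
    have h3 := h i K
    rw [add_comm, add_eq_zero_iff_eq_neg] at h3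
    rw [h3]
    field_simp
  simp_rw [h2]
  rw [← Finset.mul_sum, h1, neg_mul_neg]
  simp_rw [flux_eq, neg_mul, Finset.sum_neg_distrib, mul_neg]

/-- At a zero of a nonnegative solution, all incoming contributions vanish. -/
theorem IsStep.zero_at (h : M.IsStep Δt η α B v u) (hΔt : 0 < Δt) (hη : 0 ≤ η)
    (hu : ∀ i K, 0 ≤ u i K) (hv : ∀ i K, 0 ≤ v i K) {i : Fin n} {K : M.Cell} (hK : u i K = 0) :
    v i K = 0 ∧ ∀ σ ∈ M.edges K, M.trans σ * (η ^ α * u i (M.opp K σ)) = 0 := by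
  have h1 := h i K
  -- With `u i K = 0` there is no outflow. The cell balance then says that nonnegative quantities,
  -- among them the previous mass, add up to 0.
  have hflux : ∀ σ, M.flux η α B u i K σ = -(M.trans σ * (u i (M.opp K σ) *
      max (M.jump (M.pressure B u i) K σ) 0)) - M.trans σ * (η ^ α * u i (M.opp K σ)) := by
    intro σ
    have hj : M.jump (u i) K σ = u i (M.opp K σ) := by rw [jump, hK, sub_zero]
    rw [flux_eq, mobility_mul_jump, hK, hj]
    ring
  have hη' : 0 ≤ η ^ α := Real.rpow_nonneg hη α
  have hA : ∀ σ, 0 ≤ M.trans σ * (u i (M.opp K σ) *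
      max (M.jump (M.pressure B u i) K σ) 0) := fun σ =>
    mul_nonneg (M.trans_nonneg σ) (mul_nonneg (hu _ _) (le_max_right _ _))
  have hB : ∀ σ, 0 ≤ M.trans σ * (η ^ α * u i (M.opp K σ)) := fun σ =>
    mul_nonneg (M.trans_nonneg σ) (mul_nonneg hη' (hu _ _))
  simp_rw [hflux] at h1
  rw [hK, zero_sub, Finset.sum_sub_distrib, Finset.sum_neg_distrib] at h1
  have hSA := Finset.sum_nonneg (s := M.edges K) fun σ _ => hA σ
  have hSB := Finset.sum_nonneg (s := M.edges K) fun σ _ => hB σ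
  have hm := M.cellMeas_pos K
  have h2 : M.cellMeas K * (-v i K / Δt) = -(M.cellMeas K / Δt * v i K) := by ring
  rw [h2] at h1
  have hc : 0 < M.cellMeas K / Δt := div_pos hm hΔt
  have h3 : 0 ≤ M.cellMeas K / Δt * v i K := mul_nonneg hc.le (hv i K)
  refine ⟨?_, (Finset.sum_eq_zero_iff_of_nonneg fun σ _ => hB σ).1 (by linarith)⟩
  have h4 : M.cellMeas K / Δt * v i K = 0 := by linarith
  exact (mul_eq_zero.1 h4).resolve_left hc.ne'

/-- A zero of `u i` forces a zero of `v i` in the same cell. If `η > 0`, linear diffusion also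
spreads the zero to all neighbors, hence to every cell, so that `v i` vanishes identically. -/
theorem IsStep.pos (h : M.IsStep Δt η α B v u) (hΩ : IsPolyhedralDomain Ω) (hΔt : 0 < Δt)
    (hη : 0 ≤ η) (hu : ∀ i K, 0 ≤ u i K) (hv : ∀ i K, 0 ≤ v i K) {i : Fin n}
    (hi : (∀ K, 0 < v i K) ∨ (0 < η ∧ ∃ K, 0 < v i K)) (K : M.Cell) : 0 < u i K := by
  refine (hu i K).lt_of_ne' fun hK => ?_
  rcases hi with hi | ⟨hη0, L, hL⟩
  · exact (hi K).ne' (h.zero_at hΔt hη hu hv hK).1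
  · have huniv := M.eq_univ_of_neighbor_closed hΩ (S := {K | u i K = 0}) ⟨K, hK⟩
      fun K hK N hKN σ hσK hσN => by
        have h1 := (h.zero_at hΔt hη hu hv hK).2 σ hσK
        rw [M.opp_of_interior hKN hσK hσN] at h1
        have h2 := (mul_eq_zero.1 h1).resolve_left (M.trans_pos hΩ.isBounded hKN hσK hσN).ne'
        exact (mul_eq_zero.1 h2).resolve_left (Real.rpow_pos_of_pos hη0 α).ne'
    have hLz : u i L = 0 := huniv.ge (Set.mem_univ L)
    exact hL.ne' (h.zero_at hΔt hη hu hv hLz).1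

end Step

end AdmissibleMesh

/-! ### Calculus of locally Lipschitz functions -/

section LocallyLipschitz

variable {X : Type*} [PseudoMetricSpace X]

theorem LocallyLipschitz.mul_real {f g : X → ℝ} (hf : LocallyLipschitz f)
    (hg : LocallyLipschitz g) : LocallyLipschitz fun x => f x * g x :=
  (contDiff_mul (𝕜 := ℝ) (n := 1)).locallyLipschitz.comp (hf.prodMk hg)

theorem LocallyLipschitz.sum_real {ι : Type*} (s : Finset ι) {f : ι → X → ℝ}
    (hf : ∀ i ∈ s, LocallyLipschitz (f i)) : LocallyLipschitz fun x => ∑ i ∈ s, f i x := by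
  classical
  induction s using Finset.induction_on with
  | empty => simpa using LocallyLipschitz.const (0 : ℝ)
  | insert a s ha ih =>
    simp_rw [Finset.sum_insert ha]
    exact (hf a (Finset.mem_insert_self a s)).add
      (ih fun i hi => hf i (Finset.mem_insert_of_mem hi))

/-- A map into a Euclidean space with locally Lipschitz coordinates is Lipschitz on compact
sets. -/
theorem exists_lipschitzOnWith_toLp {ι : Type*} [Fintype ι] {f : X → ι → ℝ} {K : Set X}
    (hK : IsCompact K) (hf : ∀ i, LocallyLipschitz fun x => f x i) :
    ∃ C, LipschitzOnWith C (fun x => (WithLp.toLp 2 (f x) : EuclideanSpace ℝ ι)) K := by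
  choose C hC using fun i =>
    ((hf i).locallyLipschitzOn (s := K)).exists_lipschitzOnWith_of_compact hK
  have hpi : LipschitzOnWith (∑ i, C i) f K := LipschitzOnWith.of_dist_le_mul fun x hx y hy => by
    refine (dist_pi_le_iff (by positivity)).2 fun i => ?_
    refine ((hC i).dist_le_mul x hx y hy).trans ?_
    gcongr
    exact Finset.single_le_sum (f := C) (fun j _ => zero_le) (Finset.mem_univ i)
  exact ⟨_, (PiLp.lipschitzWith_toLp 2 fun _ : ι => ℝ).comp_lipschitzOnWith hpi⟩

end LocallyLipschitz

/-! ### Existence for one time step -/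

namespace AdmissibleMesh

variable {d n : ℕ} {Ω : Set (EuclideanSpace ℝ (Fin d))} (M : AdmissibleMesh Ω)

/-- The residual of the scheme in the cell `K`, divided by `-m(K)`. -/
noncomputable def residual (Δt η α : ℝ) (B : Matrix (Fin n) (Fin n) ℝ)
    (v u : Fin n → M.Cell → ℝ) (i : Fin n) (K : M.Cell) : ℝ :=
  (v i K - u i K) / Δt - (M.cellMeas K)⁻¹ * ∑ σ ∈ M.edges K, M.flux η α B u i K σ

/-- The rate at which mass leaves the cell `K`. -/
noncomputable def outflowRate (η α : ℝ) (B : Matrix (Fin n) (Fin n) ℝ)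
    (u : Fin n → M.Cell → ℝ) (i : Fin n) (K : M.Cell) : ℝ :=
  (M.cellMeas K)⁻¹ * ∑ σ ∈ M.edges K,
    M.trans σ * (max (-M.jump (M.pressure B u i) K σ) 0 + η ^ α)

variable {M} {Δt η α : ℝ} {B : Matrix (Fin n) (Fin n) ℝ} {v u : Fin n → M.Cell → ℝ}

theorem isStep_of_residual_eq_zero (h : ∀ i K, M.residual Δt η α B v u i K = 0) :
    M.IsStep Δt η α B v u := by
  intro i K
  have h1 := h i K
  have hm := (M.cellMeas_pos K).ne'
  rw [residual, sub_eq_zero] at h1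
  rw [show (u i K - v i K) / Δt = -((v i K - u i K) / Δt) by ring, h1]
  field_simp
  ring

theorem sum_residual (i : Fin n) : ∑ K, M.cellMeas K * M.residual Δt η α B v u i K
    = (∑ K, M.cellMeas K * v i K - ∑ K, M.cellMeas K * u i K) / Δt := by
  have h : ∀ K, M.cellMeas K * M.residual Δt η α B v u i K
      = (M.cellMeas K * v i K - M.cellMeas K * u i K) / Δt
        - ∑ σ ∈ M.edges K, M.flux η α B u i K σ := fun K => by
    have hm := (M.cellMeas_pos K).ne'
    rw [residual, mul_sub, mul_inv_cancel_left₀ hm]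
    ring
  simp_rw [h]
  rw [Finset.sum_sub_distrib, M.sum_flux_eq_zero, sub_zero, ← Finset.sum_div,
    Finset.sum_sub_distrib]

/-- The residual is bounded below by the outflow. -/
theorem neg_le_residual (hΔt : 0 < Δt) (hη : 0 ≤ η) (hv : ∀ i K, 0 ≤ v i K)
    (hu : ∀ i K, 0 ≤ u i K) (i : Fin n) (K : M.Cell) :
    -((1 / Δt + M.outflowRate η α B u i K) * u i K) ≤ M.residual Δt η α B v u i K := by
  have hη' : 0 ≤ η ^ α := Real.rpow_nonneg hη α
  have hflux : ∀ σ, M.flux η α B u i K σ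
      ≤ M.trans σ * (max (-M.jump (M.pressure B u i) K σ) 0 + η ^ α) * u i K := fun σ => by
    have hj : M.jump (u i) K σ = u i (M.opp K σ) - u i K := rfl
    rw [flux_eq, mobility_mul_jump, hj]
    have h1 := mul_nonneg (M.trans_nonneg σ) (mul_nonneg (hu i (M.opp K σ))
      (le_max_right (M.jump (M.pressure B u i) K σ) 0))
    have h2 := mul_nonneg (M.trans_nonneg σ) (mul_nonneg hη' (hu i (M.opp K σ)))
    linarith
  have hsum := Finset.sum_le_sum fun σ (_ : σ ∈ M.edges K) => hflux σ
  rw [← Finset.sum_mul] at hsum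
  have hm := inv_nonneg.2 (M.cellMeas_pos K).le
  have h1 := mul_le_mul_of_nonneg_left hsum hm
  have h2 : 0 ≤ v i K / Δt := div_nonneg (hv i K) hΔt.le
  rw [residual, outflowRate, sub_div]
  have h3 : u i K / Δt = 1 / Δt * u i K := by ring
  rw [h3]
  linarith

/-- Existence of a nonnegative solution of one time step. -/
theorem exists_isStep (M : AdmissibleMesh Ω) (hΔt : 0 < Δt) (hη : 0 ≤ η)
    (B : Matrix (Fin n) (Fin n) ℝ) {v : Fin n → M.Cell → ℝ} (hv : ∀ i K, 0 ≤ v i K) :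
    ∃ u : Fin n → M.Cell → ℝ, M.IsStep Δt η α B v u ∧ ∀ i K, 0 ≤ u i K := by
  let U : EuclideanSpace ℝ (Fin n × M.Cell) → Fin n → M.Cell → ℝ := fun x i K => x (i, K)
  -- Nonnegativity together with fixed masses bounds every coordinate, since cells have positive
  -- measure.
  let S : Set (EuclideanSpace ℝ (Fin n × M.Cell)) := {x | (∀ p, 0 ≤ x p) ∧
    ∀ i, ∑ K, M.cellMeas K * x (i, K) = ∑ K, M.cellMeas K * v i K}
  have hcoord : ∀ p, Continuous fun x : EuclideanSpace ℝ (Fin n × M.Cell) => x p := fun p => by fun_prop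
  have hSclosed : IsClosed S := by
    have : S = (⋂ p, {x | 0 ≤ x p}) ∩
        ⋂ i, {x | ∑ K, M.cellMeas K * x (i, K) = ∑ K, M.cellMeas K * v i K} := by
      ext x
      simp [S]
    rw [this]
    refine IsClosed.inter (isClosed_iInter fun p => isClosed_le continuous_const (hcoord p))
      (isClosed_iInter fun i => isClosed_eq (continuous_finsetSum _ fun K _ => ?_)
        continuous_const)
    exact continuous_const.mul (hcoord _)
  have hSbdd : ∀ x ∈ S, ∀ p : Fin n × M.Cell,
      x p ≤ (M.cellMeas p.2)⁻¹ * ∑ K, M.cellMeas K * v p.1 K := by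
    rintro x ⟨hx0, hx⟩ ⟨i, K⟩
    rw [← hx i, le_inv_mul_iff₀ (M.cellMeas_pos K)]
    exact Finset.single_le_sum (f := fun K => M.cellMeas K * x (i, K))
      (fun L _ => mul_nonneg (M.cellMeas_pos L).le (hx0 _)) (Finset.mem_univ K)
  have hScompact : IsCompact S := by
    refine IsCompact.of_isClosed_subset ((isCompact_Icc (a := (0 : Fin n × M.Cell → ℝ))
      (b := fun p => (M.cellMeas p.2)⁻¹ * ∑ K, M.cellMeas K * v p.1 K)).image
      (PiLp.continuous_toLp 2 fun _ : Fin n × M.Cell => ℝ)) hSclosed fun x hx => ?_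
    exact ⟨WithLp.ofLp x, ⟨fun p => hx.1 p, fun p => hSbdd x hx p⟩, rfl⟩
  have hSne : S.Nonempty := ⟨WithLp.toLp 2 fun p => v p.1 p.2, fun p => hv _ _, fun i => rfl⟩
  have hSconv : Convex ℝ S := by
    rintro x ⟨hx0, hx⟩ y ⟨hy0, hy⟩ a b ha hb hab
    refine ⟨fun p => ?_, fun i => ?_⟩
    · exact add_nonneg (mul_nonneg ha (hx0 p)) (mul_nonneg hb (hy0 p))
    · have : ∀ K, M.cellMeas K * (a • x + b • y) (i, K)
          = a * (M.cellMeas K * x (i, K)) + b * (M.cellMeas K * y (i, K)) := fun K => by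
        simp only [PiLp.add_apply, PiLp.smul_apply, smul_eq_mul]
        ring
      simp_rw [this]
      rw [Finset.sum_add_distrib, ← Finset.mul_sum, ← Finset.mul_sum, hx, hy, ← add_mul, hab,
        one_mul]
  have hlin : ∀ p, LocallyLipschitz fun x : EuclideanSpace ℝ (Fin n × M.Cell) => x p := fun p =>
    ContDiff.locallyLipschitz (𝕂 := ℝ) (by fun_prop)
  have hjump : ∀ i K σ, LocallyLipschitz fun x : EuclideanSpace ℝ (Fin n × M.Cell) => M.jump (M.pressure B (U x) i) K σ :=
    fun i K σ => ContDiff.locallyLipschitz (𝕂 := ℝ) (by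
      simp only [jump, pressure, U]
      fun_prop)
  have hflux : ∀ i K σ, LocallyLipschitz fun x : EuclideanSpace ℝ (Fin n × M.Cell) => M.flux η α B (U x) i K σ := by
    intro i K σ
    simp_rw [flux_eq, mobility_mul_jump]
    refine LocallyLipschitz.neg ((LocallyLipschitz.const _).mul_real (LocallyLipschitz.add
      (LocallyLipschitz.sub ((hlin _).mul_real ((hjump i K σ).max_const 0))
        ((hlin _).mul_real ((hjump i K σ).neg.max_const 0))) ?_))
    exact ContDiff.locallyLipschitz (𝕂 := ℝ) (by
      simp only [jump, U]
      fun_prop)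
  have hres : ∀ i K, LocallyLipschitz fun x : EuclideanSpace ℝ (Fin n × M.Cell) => M.residual Δt η α B v (U x) i K := by
    intro i K
    simp only [residual]
    refine LocallyLipschitz.sub (ContDiff.locallyLipschitz (𝕂 := ℝ) ?_)
      ((LocallyLipschitz.const _).mul_real (LocallyLipschitz.sum_real _ fun σ _ => hflux i K σ))
    simp only [U]
    fun_prop
  have hout : ∀ p : Fin n × M.Cell, ∃ C, ∀ x ∈ S, ‖M.outflowRate η α B (U x) p.1 p.2‖ ≤ C :=
    fun p => hScompact.exists_bound_of_continuousOn (by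
      simp only [outflowRate]
      exact (continuous_const.mul (continuous_finsetSum _ fun σ _ => continuous_const.mul
        (((hjump _ _ σ).continuous.neg.max continuous_const).add
          continuous_const))).continuousOn)
  choose C hC using hout
  obtain ⟨x₀, hx₀⟩ := hSne
  have hC0 : ∀ p, 0 ≤ C p := fun p => (norm_nonneg _).trans (hC p x₀ hx₀)
  -- `A` dominates every total loss rate `1 / Δt + outflowRate` on `S`, so a step of length `A⁻¹`
  -- removes at most the content of a cell.
  let A : ℝ := 1 / Δt + ∑ p, C p
  have hA : 0 < A := add_pos_of_pos_of_nonneg (by positivity) (Finset.sum_nonneg fun p _ => hC0 p)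
  let f : EuclideanSpace ℝ (Fin n × M.Cell) → Fin n × M.Cell → ℝ := fun x p =>
    x p + A⁻¹ * M.residual Δt η α B v (U x) p.1 p.2
  obtain ⟨L, hL⟩ := exists_lipschitzOnWith_toLp (f := f) hScompact fun p =>
    (hlin p).add ((LocallyLipschitz.const _).mul_real (hres p.1 p.2))
  have hmaps : Set.MapsTo (fun x => (WithLp.toLp 2 (f x) :
    EuclideanSpace ℝ (Fin n × M.Cell))) S S := by
    rintro x ⟨hx0, hx⟩
    refine ⟨fun p => ?_, fun i => ?_⟩
    · have h1 := neg_le_residual (α := α) (B := B) hΔt hη hv (u := U x)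
        (fun i K => hx0 (i, K)) p.1 p.2
      have h2 : M.outflowRate η α B (U x) p.1 p.2 ≤ ∑ p, C p :=
        ((Real.le_norm_self _).trans (hC p x ⟨hx0, hx⟩)).trans
          (Finset.single_le_sum (fun q _ => hC0 q) (Finset.mem_univ p))
      have h3 : (1 / Δt + M.outflowRate η α B (U x) p.1 p.2) * U x p.1 p.2 ≤ A * x p :=
        mul_le_mul_of_nonneg_right (by simpa [A] using h2) (hx0 p)
      have h4 : A⁻¹ * -(A * x p) ≤ A⁻¹ * M.residual Δt η α B v (U x) p.1 p.2 :=
        mul_le_mul_of_nonneg_left (by linarith) (inv_nonneg.2 hA.le)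
      rw [mul_neg, inv_mul_cancel_left₀ hA.ne'] at h4
      show 0 ≤ f x p
      simp only [f]
      linarith
    · show ∑ K, M.cellMeas K * f x (i, K) = _
      have h1 : ∀ K, M.cellMeas K * f x (i, K) = M.cellMeas K * x (i, K)
          + A⁻¹ * (M.cellMeas K * M.residual Δt η α B v (U x) i K) := fun K => by
        simp only [f]
        ring
      simp_rw [h1]
      rw [Finset.sum_add_distrib, ← Finset.mul_sum, sum_residual]
      have h2 : ∑ K, M.cellMeas K * U x i K = ∑ K, M.cellMeas K * v i K := hx i
      rw [h2, sub_self, zero_div, mul_zero, add_zero]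
  obtain ⟨x, hxS, hx⟩ := exists_fixedPoint_of_lipschitzOn ⟨x₀, hx₀⟩ hScompact hSconv hL hmaps
  refine ⟨U x, isStep_of_residual_eq_zero fun i K => ?_, fun i K => hxS.1 (i, K)⟩
  have h1 : f x (i, K) = x (i, K) := congrArg (fun y : EuclideanSpace ℝ (Fin n × M.Cell) => y (i, K)) hx
  simp only [f, add_eq_left] at h1
  exact (mul_eq_zero.1 h1).resolve_left (inv_ne_zero hA.ne')

end AdmissibleMesh

/-! ### Scalar inequalities for the logarithm -/

section ScalarInequalities

open Filter Topology

/-- Convexity of `s ↦ s (log s - 1) + 1`: its tangent at `a`, of slope `log a`, lies below the graph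
at `b`. -/
theorem shannon_tangent_le {a b : ℝ} (ha : 0 < a) (hb : 0 < b) :
    a * (Real.log a - 1) + 1 - (b * (Real.log b - 1) + 1) ≤ (a - b) * Real.log a := by
  have h1 := Real.log_le_sub_one_of_pos (div_pos ha hb)
  rw [Real.log_div ha.ne' hb.ne'] at h1
  have h2 := mul_le_mul_of_nonneg_left h1 hb.le
  have h3 : b * (a / b - 1) = a - b := by field_simp
  linarith

theorem sub_le_mul_log_sub {a b : ℝ} (ha : 0 < a) (hb : 0 < b) :
    b - a ≤ b * (Real.log b - Real.log a) ∧ a * (Real.log b - Real.log a) ≤ b - a := by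
  constructor
  · linarith [shannon_tangent_le ha hb]
  · linarith [shannon_tangent_le hb ha]

/-- With `x = √a ≤ y = √b`, the bound `log t ≥ 2 (t - 1) / (t + 1)` at `t = y / x`, multiplied by `2
(y² - x²)`, gives the claim with constant 4. -/
theorem four_mul_sq_sqrt_sub_le {a b : ℝ} (ha : 0 < a) (hb : 0 < b) :
    4 * (Real.sqrt b - Real.sqrt a) ^ 2 ≤ (b - a) * (Real.log b - Real.log a) := by
  wlog hab : a ≤ b generalizing a b
  · linarith [this hb ha (le_of_not_ge hab)]
  have hx : 0 < Real.sqrt a := Real.sqrt_pos.2 ha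
  have hy : 0 < Real.sqrt b := Real.sqrt_pos.2 hb
  have hxy : Real.sqrt a ≤ Real.sqrt b := Real.sqrt_le_sqrt hab
  set x := Real.sqrt a with hxdef
  set y := Real.sqrt b with hydef
  have hax : a = x ^ 2 := (Real.sq_sqrt ha.le).symm
  have hby : b = y ^ 2 := (Real.sq_sqrt hb.le).symm
  have h0 : 0 ≤ (y - x) / x := div_nonneg (sub_nonneg.2 hxy) hx.le
  have h1 := Real.le_log_one_add_of_nonneg h0
  have h2 : 1 + (y - x) / x = y / x := by field_simp; ring
  have h3 : 2 * ((y - x) / x) / ((y - x) / x + 2) = 2 * (y - x) / (y + x) := by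
    have : (y - x) / x + 2 = (y + x) / x := by field_simp; ring
    rw [this]
    field_simp
  rw [h2, h3, Real.log_div hy.ne' hx.ne', div_le_iff₀ (by positivity)] at h1
  rw [hax, hby, Real.log_pow, Real.log_pow]
  push_cast
  have h4 := mul_le_mul_of_nonneg_left h1 (sub_nonneg.2 hxy)
  linarith

/-- The upwind flux tested with a regularized logarithm. -/
theorem upwind_mul_log_ge {x y P ε : ℝ} (hx : 0 ≤ x) (hy : 0 ≤ y) (hε : 0 < ε) :
    P * (y - x) - |P| * |ε * Real.log (y + ε) - ε * Real.log (x + ε)|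
      ≤ (y * max P 0 - x * max (-P) 0) * (Real.log (y + ε) - Real.log (x + ε)) := by
  obtain ⟨h1, h2⟩ := sub_le_mul_log_sub (add_pos_of_nonneg_of_pos hx hε)
    (add_pos_of_nonneg_of_pos hy hε)
  set l := Real.log (y + ε)
  set m := Real.log (x + ε)
  have h3 := le_abs_self (ε * l - ε * m)
  have h4 := neg_abs_le (ε * l - ε * m)
  -- The logarithmic inequality carries the factor `y + ε` or `x + ε`, whereas the mobility is `y`
  -- or `x`. The mismatch `ε (l - m)` is the error term. The upwind choice selects the endpoint for
  -- which the inequality has the right direction.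
  rcases le_total 0 P with hP | hP
  · rw [max_eq_left hP, max_eq_right (by linarith), abs_of_nonneg hP]
    have : (y - x) - |ε * l - ε * m| ≤ y * (l - m) := by linarith
    have := mul_le_mul_of_nonneg_left this hP
    linarith
  · rw [max_eq_right hP, max_eq_left (by linarith), abs_of_nonpos hP]
    have : x * (l - m) ≤ (y - x) + |ε * l - ε * m| := by linarith
    have := mul_le_mul_of_nonneg_left this (neg_nonneg.2 hP)
    linarith

theorem tendsto_shannon_add {x : ℝ} :
    Tendsto (fun ε : ℝ => (x + ε) * (Real.log (x + ε) - 1) + 1) (𝓝[>] 0)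
      (𝓝 (x * (Real.log x - 1) + 1)) := by
  have hc : Continuous fun y : ℝ => y * (Real.log y - 1) + 1 := by
    have : (fun y : ℝ => y * (Real.log y - 1) + 1) = fun y => y * Real.log y - y + 1 := by
      ext y
      ring
    rw [this]
    exact (Real.continuous_mul_log.sub continuous_id).add continuous_const
  have h1 : Continuous fun ε : ℝ => (x + ε) * (Real.log (x + ε) - 1) + 1 :=
    hc.comp (continuous_const.add continuous_id)
  simpa using (h1.tendsto 0).mono_left nhdsWithin_le_nhds

/-- The regularization error vanishes even at `x = 0`, where the limit is that of `ε log ε`. -/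
theorem tendsto_mul_log_add {x : ℝ} (hx : 0 ≤ x) :
    Tendsto (fun ε : ℝ => ε * Real.log (x + ε)) (𝓝[>] 0) (𝓝 0) := by
  refine Tendsto.mono_left ?_ nhdsWithin_le_nhds
  rcases hx.eq_or_lt with rfl | hx
  · simpa using Real.continuous_mul_log.tendsto 0
  · have h1 : ContinuousAt (fun ε : ℝ => ε * Real.log (x + ε)) 0 := by
      refine continuousAt_id.mul (ContinuousAt.log (by fun_prop) ?_)
      simpa using hx.ne'
    simpa using h1.tendsto

end ScalarInequalities

/-! ### The quadratic form of a matrix and its square root -/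

section SqrtMatrix

variable {n : ℕ} {B : Matrix (Fin n) (Fin n) ℝ}

theorem sum_sq_sqrt_mul (hB : B.PosSemidef) (x : Fin n → ℝ) :
    ∑ i, (∑ j, CFC.sqrt B i j * x j) ^ 2 = ∑ i, (∑ j, B i j * x j) * x i := by
  have hS : (CFC.sqrt B).PosSemidef := Matrix.nonneg_iff_posSemidef.1 (CFC.sqrt_nonneg B)
  have hmul : CFC.sqrt B * CFC.sqrt B = B :=
    CFC.sqrt_mul_sqrt_self B (Matrix.nonneg_iff_posSemidef.2 hB)
  have hT : (CFC.sqrt B).transpose = CFC.sqrt B := by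
    simpa [Matrix.conjTranspose_eq_transpose_of_trivial] using hS.isHermitian.eq
  calc ∑ i, (∑ j, CFC.sqrt B i j * x j) ^ 2
      = (CFC.sqrt B).mulVec x ⬝ᵥ (CFC.sqrt B).mulVec x := by
        simp [dotProduct, Matrix.mulVec, pow_two]
    _ = B.mulVec x ⬝ᵥ x := by
        rw [Matrix.dotProduct_mulVec, ← Matrix.mulVec_transpose, hT, Matrix.mulVec_mulVec, hmul]
    _ = _ := by simp [dotProduct, Matrix.mulVec]

theorem sum_mul_mul_nonneg (hB : B.PosSemidef) (x : Fin n → ℝ) :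
    0 ≤ ∑ i, (∑ j, B i j * x j) * x i :=
  sum_sq_sqrt_mul hB x ▸ Finset.sum_nonneg fun _ _ => sq_nonneg _

end SqrtMatrix

/-! ### Entropy inequalities and the initial datum -/

namespace AdmissibleMesh

open Filter Topology

variable {d n : ℕ} {Ω : Set (EuclideanSpace ℝ (Fin d))} (M : AdmissibleMesh Ω)

theorem shannon_eq (u : Fin n → M.Cell → ℝ) :
    M.shannon u = ∑ i, ∑ K, M.cellMeas K * (u i K * (Real.log (u i K) - 1) + 1) := by
  rw [shannon, M.setIntegral_pc fun y => ∑ i, (y i * (Real.log (y i) - 1) + 1), Finset.sum_comm]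
  simp_rw [Finset.mul_sum]

theorem rao_eq (B : Matrix (Fin n) (Fin n) ℝ) (u : Fin n → M.Cell → ℝ) :
    M.rao B u = ∑ K, M.cellMeas K * ((1 / 2) * ∑ i, (∑ j, B i j * u j K) * u i K) := by
  rw [rao, M.setIntegral_pc fun y => (1 / 2) * ∑ i, ∑ j, B i j * y i * y j]
  refine Finset.sum_congr rfl fun K _ => ?_
  congr 2
  refine Finset.sum_congr rfl fun i _ => ?_
  rw [Finset.sum_mul]
  exact Finset.sum_congr rfl fun j _ => by ring

theorem seminormSq_eq (v : M.Cell → ℝ) :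
    M.seminormSq v = ∑ σ, M.trans σ * M.jump v (M.side σ) σ ^ 2 := by
  refine Finset.sum_congr rfl fun σ _ => ?_
  rw [sq_abs, absJump, div_pow, sq_abs, trans]
  -- For `d_σ = 0`, division by zero gives 0 on both sides, in agreement with the convention `τ_σ =
  -- 0`.
  by_cases h : M.edgeDist σ = 0
  · simp [h]
  · field_simp

/-- This identifies the cross-diffusion dissipation. The term of a single species has no sign; only
the sum over `i` is a square. -/
theorem sqrtSeminormSq_eq {B : Matrix (Fin n) (Fin n) ℝ} (hB : B.PosSemidef)
    (u : Fin n → M.Cell → ℝ) : M.sqrtSeminormSq B u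
      = ∑ i, ∑ σ, M.trans σ *
        (M.jump (M.pressure B u i) (M.side σ) σ * M.jump (u i) (M.side σ) σ) := by
  simp_rw [sqrtSeminormSq, seminormSq_eq]
  rw [Finset.sum_comm, Finset.sum_comm (f := fun i σ => M.trans σ *
        (M.jump (M.pressure B u i) (M.side σ) σ * M.jump (u i) (M.side σ) σ))]
  refine Finset.sum_congr rfl fun σ _ => ?_
  rw [← Finset.mul_sum, ← Finset.mul_sum]
  congr 1
  simp_rw [jump_pressure]
  rw [← sum_sq_sqrt_mul hB]
  refine Finset.sum_congr rfl fun i _ => ?_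
  simp only [jump, mul_sub, Finset.sum_sub_distrib]

variable {M} {B : Matrix (Fin n) (Fin n) ℝ} {u v : Fin n → M.Cell → ℝ} {Δt η α : ℝ}

/-- The entropy inequality for one species and one time step. -/
theorem IsStep.sum_shannon_le (h : M.IsStep Δt η α B v u) (hΔt : 0 < Δt) (hη : 0 ≤ η)
    (hu : ∀ i K, 0 ≤ u i K) (hv : ∀ i K, 0 ≤ v i K) (i : Fin n) :
    ∑ K, M.cellMeas K * (u i K * (Real.log (u i K) - 1) + 1)
      + Δt * ∑ σ, M.trans σ *
        (M.jump (M.pressure B u i) (M.side σ) σ * M.jump (u i) (M.side σ) σ)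
      + 4 * η ^ α * (Δt * M.seminormSq fun K => Real.sqrt (u i K))
      ≤ ∑ K, M.cellMeas K * (v i K * (Real.log (v i K) - 1) + 1) := by
  have hη' : 0 ≤ η ^ α := Real.rpow_nonneg hη α
  set P : M.Edge → ℝ := fun σ => M.jump (M.pressure B u i) (M.side σ) σ with hP
  set x : M.Edge → ℝ := fun σ => u i (M.side σ) with hx
  set y : M.Edge → ℝ := fun σ => u i (M.opp (M.side σ) σ) with hy
  have hx0 : ∀ σ, 0 ≤ x σ := fun σ => hu _ _
  have hy0 : ∀ σ, 0 ≤ y σ := fun σ => hu _ _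
  -- The solution may vanish, so the test function is `log (u i + ε)`; adding `ε` to both iterates
  -- leaves their difference unchanged.
  have hreg : ∀ ε : ℝ, 0 < ε →
      ∑ K, M.cellMeas K * ((u i K + ε) * (Real.log (u i K + ε) - 1) + 1)
        + Δt * ∑ σ, M.trans σ * (P σ * (y σ - x σ)
          - |P σ| * |ε * Real.log (y σ + ε) - ε * Real.log (x σ + ε)|
          + η ^ α * (4 * (Real.sqrt (y σ + ε) - Real.sqrt (x σ + ε)) ^ 2))
        ≤ ∑ K, M.cellMeas K * ((v i K + ε) * (Real.log (v i K + ε) - 1) + 1) := by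
    intro ε hε
    have h1 := h.sum_mul hΔt i fun K => Real.log (u i K + ε)
    have h2 : ∑ K, M.cellMeas K * ((u i K + ε) * (Real.log (u i K + ε) - 1) + 1)
        - ∑ K, M.cellMeas K * ((v i K + ε) * (Real.log (v i K + ε) - 1) + 1)
        ≤ ∑ K, M.cellMeas K * ((u i K - v i K) * Real.log (u i K + ε)) := by
      rw [← Finset.sum_sub_distrib]
      refine Finset.sum_le_sum fun K _ => ?_
      rw [← mul_sub]
      refine mul_le_mul_of_nonneg_left ?_ (M.cellMeas_pos K).le
      have := shannon_tangent_le (add_pos_of_nonneg_of_pos (hu i K) hε)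
        (add_pos_of_nonneg_of_pos (hv i K) hε)
      rwa [add_sub_add_right_eq_sub (u i K) (v i K)] at this
    have h3 : ∑ σ, M.trans σ * (P σ * (y σ - x σ)
          - |P σ| * |ε * Real.log (y σ + ε) - ε * Real.log (x σ + ε)|
          + η ^ α * (4 * (Real.sqrt (y σ + ε) - Real.sqrt (x σ + ε)) ^ 2))
        ≤ ∑ σ, M.trans σ * (M.mobility B u i (M.side σ) σ *
          M.jump (M.pressure B u i) (M.side σ) σ + η ^ α * M.jump (u i) (M.side σ) σ)
          * M.jump (fun K => Real.log (u i K + ε)) (M.side σ) σ := by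
      refine Finset.sum_le_sum fun σ _ => ?_
      rw [mul_assoc]
      refine mul_le_mul_of_nonneg_left ?_ (M.trans_nonneg σ)
      rw [mobility_mul_jump, add_mul, mul_assoc]
      refine add_le_add (upwind_mul_log_ge (hx0 σ) (hy0 σ) hε)
        (mul_le_mul_of_nonneg_left ?_ hη')
      have := four_mul_sq_sqrt_sub_le (add_pos_of_nonneg_of_pos (hx0 σ) hε)
        (add_pos_of_nonneg_of_pos (hy0 σ) hε)
      rwa [add_sub_add_right_eq_sub] at this
    have h4 := mul_le_mul_of_nonneg_left h3 hΔt.le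
    linarith
  have hsqrt : ∀ z : ℝ, Tendsto (fun ε : ℝ => Real.sqrt (z + ε)) (𝓝[>] 0) (𝓝 (Real.sqrt z)) := by
    intro z
    have h1 : Continuous fun ε : ℝ => Real.sqrt (z + ε) := by fun_prop
    simpa using (h1.tendsto 0).mono_left nhdsWithin_le_nhds
  have hR : Tendsto (fun ε : ℝ =>
      ∑ K, M.cellMeas K * ((v i K + ε) * (Real.log (v i K + ε) - 1) + 1)) (𝓝[>] 0)
      (𝓝 (∑ K, M.cellMeas K * (v i K * (Real.log (v i K) - 1) + 1))) :=
    tendsto_finsetSum _ fun K _ => tendsto_shannon_add.const_mul _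
  have hL : Tendsto (fun ε : ℝ =>
      ∑ K, M.cellMeas K * ((u i K + ε) * (Real.log (u i K + ε) - 1) + 1)
        + Δt * ∑ σ, M.trans σ * (P σ * (y σ - x σ)
          - |P σ| * |ε * Real.log (y σ + ε) - ε * Real.log (x σ + ε)|
          + η ^ α * (4 * (Real.sqrt (y σ + ε) - Real.sqrt (x σ + ε)) ^ 2))) (𝓝[>] 0)
      (𝓝 (∑ K, M.cellMeas K * (u i K * (Real.log (u i K) - 1) + 1)
        + Δt * ∑ σ, M.trans σ * (P σ * (y σ - x σ) - |P σ| * |0 - 0|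
          + η ^ α * (4 * (Real.sqrt (y σ) - Real.sqrt (x σ)) ^ 2)))) := by
    refine (tendsto_finsetSum _ fun K _ => tendsto_shannon_add.const_mul _).add
      ((tendsto_finsetSum _ fun σ _ => Tendsto.const_mul _ (Tendsto.add
        (tendsto_const_nhds.sub (Tendsto.const_mul _ (Tendsto.abs
          ((tendsto_mul_log_add (hy0 σ)).sub (tendsto_mul_log_add (hx0 σ))))))
        ((Tendsto.const_mul _ (((hsqrt _).sub (hsqrt _)).pow 2)).const_mul _))).const_mul _)
  have hlim := le_of_tendsto_of_tendsto hL hR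
    (eventually_mem_nhdsWithin.mono fun ε hε => hreg ε hε)
  refine le_trans (le_of_eq ?_) hlim
  rw [seminormSq_eq, add_assoc, Finset.mul_sum, Finset.mul_sum, Finset.mul_sum, Finset.mul_sum,
    ← Finset.sum_add_distrib]
  congr 1
  refine Finset.sum_congr rfl fun σ _ => ?_
  simp only [jump, sub_self, abs_zero, mul_zero, sub_zero, hP, hx, hy]
  ring

/-- The Shannon entropy inequality for one time step. -/
theorem IsStep.shannon_le (h : M.IsStep Δt η α B v u) (hB : B.PosSemidef) (hΔt : 0 < Δt)
    (hη : 0 ≤ η) (hu : ∀ i K, 0 ≤ u i K) (hv : ∀ i K, 0 ≤ v i K) :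
    M.shannon u + Δt * M.sqrtSeminormSq B u
      + 4 * η ^ α * (Δt * ∑ i, M.seminormSq fun K => Real.sqrt (u i K)) ≤ M.shannon v := by
  have := Finset.sum_le_sum fun i (_ : i ∈ Finset.univ) => h.sum_shannon_le hΔt hη hu hv i
  rw [Finset.sum_add_distrib, Finset.sum_add_distrib, ← Finset.mul_sum, ← Finset.mul_sum,
    ← Finset.mul_sum] at this
  rwa [shannon_eq, shannon_eq, sqrtSeminormSq_eq _ hB]

/-- The Rao entropy inequality for one time step. -/
theorem IsStep.rao_le (h : M.IsStep Δt η α B v u) (hB : B.PosSemidef) (hΔt : 0 < Δt)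
    (hη : 0 ≤ η) : M.rao B u + Δt * M.raoDissipation B u ≤ M.rao B v := by
  have hη' : 0 ≤ η ^ α := Real.rpow_nonneg hη α
  have hsymm : ∀ i j, B i j = B j i := fun i j => by
    simpa using (hB.isHermitian.apply i j).symm
  -- Convexity of the quadratic form: the difference of the two sides is half the form evaluated at
  -- `u - v`.
  have hconv : ∀ K, (1 / 2) * ∑ i, (∑ j, B i j * u j K) * u i K
      - (1 / 2) * ∑ i, (∑ j, B i j * v j K) * v i K
      ≤ ∑ i, (u i K - v i K) * M.pressure B u i K := by
    intro K
    have h1 := sum_mul_mul_nonneg hB fun i => u i K - v i K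
    have h2 : ∑ i, (∑ j, B i j * u j K) * v i K = ∑ i, (∑ j, B i j * v j K) * u i K := by
      simp_rw [Finset.sum_mul]
      rw [Finset.sum_comm]
      refine Finset.sum_congr rfl fun i _ => Finset.sum_congr rfl fun j _ => ?_
      rw [hsymm j i]
      ring
    simp only [mul_sub, sub_mul, Finset.sum_sub_distrib] at h1
    simp only [pressure, sub_mul, Finset.sum_sub_distrib, mul_comm (u _ K) (∑ j, _),
      mul_comm (v _ K) (∑ j, _)]
    linarith
  have h1 : M.rao B u - M.rao B v
      ≤ ∑ i, ∑ K, M.cellMeas K * ((u i K - v i K) * M.pressure B u i K) := by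
    rw [rao_eq, rao_eq, ← Finset.sum_sub_distrib, Finset.sum_comm]
    refine Finset.sum_le_sum fun K _ => ?_
    rw [← mul_sub, ← Finset.mul_sum]
    exact mul_le_mul_of_nonneg_left (hconv K) (M.cellMeas_pos K).le
  -- Testing with the pressure makes convection the Rao dissipation; linear diffusion adds a
  -- nonnegative multiple of `|B^{1/2} u|²`, which is discarded.
  have h2 : ∑ i, ∑ K, M.cellMeas K * ((u i K - v i K) * M.pressure B u i K)
      = -(Δt * (M.raoDissipation B u + η ^ α * M.sqrtSeminormSq B u)) := by
    rw [sqrtSeminormSq_eq _ hB, raoDissipation, Finset.mul_sum, ← Finset.sum_add_distrib,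
      Finset.mul_sum, ← Finset.sum_neg_distrib]
    refine Finset.sum_congr rfl fun i _ => ?_
    rw [h.sum_mul hΔt i (M.pressure B u i), Finset.mul_sum (s := Finset.univ) (a := η ^ α),
      ← Finset.sum_add_distrib]
    congr 2
    refine Finset.sum_congr rfl fun σ _ => ?_
    rw [absJump, sq_abs]
    ring
  have h3 : 0 ≤ M.sqrtSeminormSq B u := by
    rw [sqrtSeminormSq]
    simp_rw [seminormSq_eq]
    exact Finset.sum_nonneg fun i _ => Finset.sum_nonneg fun σ _ =>
      mul_nonneg (M.trans_nonneg σ) (sq_nonneg _)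
  have h4 := mul_nonneg hΔt.le (mul_nonneg hη' h3)
  linarith

theorem raoDissipation_nonneg (M : AdmissibleMesh Ω) (B : Matrix (Fin n) (Fin n) ℝ)
    {u : Fin n → M.Cell → ℝ} (hu : ∀ i K, 0 ≤ u i K) : 0 ≤ M.raoDissipation B u :=
  Finset.sum_nonneg fun _ _ => Finset.sum_nonneg fun σ _ =>
    mul_nonneg (mul_nonneg (M.trans_nonneg σ) (M.mobility_nonneg hu _ _ _)) (sq_nonneg _)

/-- The summed entropy inequalities. -/
theorem entropy_inequalities (hB : B.PosSemidef) (hΔt : 0 < Δt) (hη : 0 ≤ η)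
    (u : ℕ → Fin n → M.Cell → ℝ) (k : ℕ) (hu0 : ∀ i K, 0 ≤ u 0 i K)
    (hu : ∀ j ∈ Finset.Icc 1 k, M.IsStep Δt η α B (u (j - 1)) (u j) ∧ ∀ i K, 0 ≤ u j i K) :
    M.shannon (u k) + ∑ j ∈ Finset.Icc 1 k, Δt * M.sqrtSeminormSq B (u j)
        + 4 * η ^ α * ∑ j ∈ Finset.Icc 1 k, Δt *
            ∑ i, M.seminormSq (fun K => Real.sqrt (u j i K))
      ≤ M.shannon (u 0) ∧
    M.rao B (u k) + ∑ j ∈ Finset.Icc 1 k, Δt * M.raoDissipation B (u j) ≤ M.rao B (u 0) := by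
  induction k with
  | zero => simp
  | succ k ih =>
    obtain ⟨h1, h2⟩ := ih fun j hj => hu j (Finset.Icc_subset_Icc_right k.le_succ hj)
    obtain ⟨hs, hpos⟩ := hu (k + 1) (by simp)
    rw [Nat.add_sub_cancel] at hs
    have hk : ∀ i K, 0 ≤ u k i K := by
      rcases Nat.eq_zero_or_pos k with rfl | hk
      · exact hu0
      · exact (hu k (Finset.mem_Icc.2 ⟨hk, k.le_succ⟩)).2
    have h3 := hs.shannon_le hB hΔt hη hpos hk
    have h4 := hs.rao_le hB hΔt hη
    simp only [Finset.sum_Icc_succ_top (Nat.le_add_left 1 k)]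
    constructor <;> linarith

theorem average_nonneg (M : AdmissibleMesh Ω)
    {uin : Fin n → EuclideanSpace ℝ (Fin d) → ℝ}
    (huin0 : ∀ i, ∀ᵐ x ∂(volume.restrict Ω), 0 ≤ uin i x) (i : Fin n) (K : M.Cell) :
    0 ≤ M.average uin i K :=
  mul_nonneg (inv_nonneg.2 (M.cellMeas_pos K).le) (integral_nonneg_of_ae
    (ae_restrict_of_ae_restrict_of_subset (M.cell_subset K) (huin0 i)))

/-- Nonnegative data with zero average in every cell has zero integral over `Ω`, because the cells
exhaust `Ω` up to a null set. -/
theorem exists_average_pos (M : AdmissibleMesh Ω)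
    {uin : Fin n → EuclideanSpace ℝ (Fin d) → ℝ} {i : Fin n}
    (huin : IntegrableOn (uin i) Ω)
    (huin0 : ∀ i, ∀ᵐ x ∂(volume.restrict Ω), 0 ≤ uin i x) (hpos : 0 < ∫ x in Ω, |uin i x|) :
    ∃ K, 0 < M.average uin i K := by
  by_contra! hle
  have habs : IntegrableOn (fun x => |uin i x|) Ω := huin.abs
  rw [M.setIntegral_eq_sum fun K => habs.mono_set (M.cell_subset K)] at hpos
  refine hpos.ne' (Finset.sum_eq_zero fun K _ => ?_)
  have h0 := (hle K).antisymm (M.average_nonneg huin0 i K)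
  rw [average] at h0
  rw [← (mul_eq_zero.1 h0).resolve_left (inv_ne_zero (M.cellMeas_pos K).ne')]
  exact integral_congr_ae ((ae_restrict_of_ae_restrict_of_subset (M.cell_subset K)
    (huin0 i)).mono fun x hx => abs_of_nonneg hx)

end AdmissibleMesh

/-! ### Iteration in time and the main theorem -/

theorem theorem2p1 {d n : ℕ} (hd : 2 ≤ d) (Ω : Set (EuclideanSpace ℝ (Fin d)))
    (hΩ : IsPolyhedralDomain Ω) (M : AdmissibleMesh Ω) (hM : M.IsRegular)
    (T : ℝ) (hT : 0 < T) (N : ℕ) (hN : 0 < N) (Δt : ℝ) (hΔt : Δt = T / N)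
    (B : Matrix (Fin n) (Fin n) ℝ) (hB : B.PosSemidef) (hrank : 1 ≤ B.rank)
    (hdiag : ∀ i, 0 < B i i)
    (η α : ℝ) (hη : 0 ≤ η) (hα0 : 0 < α) (hα2 : α < 2)
    (uin : Fin n → EuclideanSpace ℝ (Fin d) → ℝ)
    (huin : ∀ i, MemLp (uin i) 2 (volume.restrict Ω))
    (huin0 : ∀ i, ∀ᵐ x ∂(volume.restrict Ω), 0 ≤ uin i x) :
    -- solvability of one time step, with positivity
    (∀ v : Fin n → M.Cell → ℝ, (∀ i K, 0 ≤ v i K) →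
      ∃ u : Fin n → M.Cell → ℝ, M.IsStep Δt η α B v u ∧ (∀ i K, 0 ≤ u i K) ∧
        ∀ i, ((∀ K, 0 < v i K) ∨ (0 < η ∧ ∃ K, 0 < v i K)) → ∀ K, 0 < u i K) ∧
    -- entropy inequalities for all nonnegative discrete solutions
    (∀ (u : ℕ → Fin n → M.Cell → ℝ) (k : ℕ), (∀ i K, 0 ≤ u 0 i K) →
      (∀ j ∈ Finset.Icc 1 k, M.IsStep Δt η α B (u (j - 1)) (u j) ∧ ∀ i K, 0 ≤ u j i K) →
        M.shannon (u k) + ∑ j ∈ Finset.Icc 1 k, Δt * M.sqrtSeminormSq B (u j)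
            + 4 * η ^ α * ∑ j ∈ Finset.Icc 1 k, Δt *
                ∑ i, M.seminormSq (fun K => Real.sqrt (u j i K))
          ≤ M.shannon (u 0) ∧
        M.rao B (u k) + ∑ j ∈ Finset.Icc 1 k, Δt * M.raoDissipation B (u j) ≤ M.rao B (u 0) ∧
        (1 ≤ k → M.rao B (u k) ≤ M.rao B (u (k - 1)))) ∧
    -- the scheme started from the cell averages of the initial datum
    (∃ u : ℕ → Fin n → M.Cell → ℝ, u 0 = M.average uin ∧ (∀ i K, 0 ≤ u 0 i K) ∧
      (∀ j, 1 ≤ j → M.IsStep Δt η α B (u (j - 1)) (u j) ∧ ∀ i K, 0 ≤ u j i K) ∧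
      ∀ i, ((∀ K, 0 < u 0 i K) ∨ (0 < η ∧ 0 < ∫ x in Ω, |uin i x|)) →
        ∀ j, 1 ≤ j → ∀ K, 0 < u j i K) := by
  have hΔt0 : 0 < Δt := hΔt ▸ div_pos hT (Nat.cast_pos.2 hN)
  -- Stated for all `v`, with a dummy value when `v` is not nonnegative, so that the choice gives a
  -- total map to iterate.
  have hstep : ∀ v : Fin n → M.Cell → ℝ, ∃ u : Fin n → M.Cell → ℝ,
      (∀ i K, 0 ≤ v i K) → M.IsStep Δt η α B v u ∧ ∀ i K, 0 ≤ u i K := fun v => by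
    by_cases hv : ∀ i K, 0 ≤ v i K
    · obtain ⟨u, hu⟩ := M.exists_isStep (α := α) hΔt0 hη B hv
      exact ⟨u, fun _ => hu⟩
    · exact ⟨v, fun h => absurd h hv⟩
  choose next hnext using hstep
  refine ⟨fun v hv => ⟨next v, (hnext v hv).1, (hnext v hv).2, fun i hi =>
    (hnext v hv).1.pos hΩ hΔt0 hη (hnext v hv).2 hv hi⟩, fun u k hu0 hu => ?_, ?_⟩
  · obtain ⟨h1, h2⟩ := AdmissibleMesh.entropy_inequalities hB hΔt0 hη u k hu0 hu
    refine ⟨h1, h2, fun hk => ?_⟩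
    obtain ⟨hs, hpos⟩ := hu k (Finset.mem_Icc.2 ⟨hk, le_rfl⟩)
    linarith [hs.rao_le hB hΔt0 hη, mul_nonneg hΔt0.le (M.raoDissipation_nonneg B hpos)]
  · let u : ℕ → Fin n → M.Cell → ℝ := fun j => next^[j] (M.average uin)
    have hsucc : ∀ j, u (j + 1) = next (u j) := fun j => Function.iterate_succ_apply' next j _
    have hnonneg : ∀ j i K, 0 ≤ u j i K := by
      intro j
      induction j with
      | zero => exact M.average_nonneg huin0
      | succ j ih =>
        rw [hsucc]
        exact (hnext _ ih).2
    have hs : ∀ j, M.IsStep Δt η α B (u j) (u (j + 1)) := fun j => by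
      rw [hsucc]
      exact (hnext _ (hnonneg j)).1
    refine ⟨u, rfl, hnonneg 0, fun j hj => ⟨?_, hnonneg j⟩, fun i hi j hj => ?_⟩
    · obtain ⟨j, rfl⟩ := Nat.exists_eq_add_of_le' hj
      exact hs j
    · have hi0 : (∀ K, 0 < u 0 i K) ∨ (0 < η ∧ ∃ K, 0 < u 0 i K) := by
        refine hi.imp_right fun h => ⟨h.1, M.exists_average_pos ?_ huin0 h.2⟩
        have : IsFiniteMeasure (volume.restrict Ω) :=
          ⟨by simpa using hΩ.isBounded.measure_lt_top⟩
        exact (huin i).integrable one_le_two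
      -- Only the first step can need `η > 0`; afterwards all values are positive and the first
      -- alternative propagates.
      induction j, hj using Nat.le_induction with
      | base => exact (hs 0).pos hΩ hΔt0 hη (hnonneg _) (hnonneg _) hi0
      | succ j _ ih => exact (hs j).pos hΩ hΔt0 hη (hnonneg _) (hnonneg _) (Or.inl ih)
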